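/- Let $E$ be a group, let $a$ be a central element of $E$ of infinite order, and let $p,q$ be non-zero integers with $|p|\neq|q|$. Let $\Gamma$ be the group with the presentation $$\Gamma=\langle\, E,\ t \mid t a^{p} t^{-1}=a^{q}\,\rangle .$$ Then $\Gamma$ is ICC, that is, the conjugacy class in $\Gamma$ of every non-neutral element is infinite, and the group von Neumann algebra $L\Gamma$ has property Gamma. Here $L\Gamma$ is the von Neumann algebra on $\ell^2(\Gamma)$ generated by the unitaries $u_\gamma$ $(\gamma\in\Gamma)$ of the left regular representation, with its canonical trace $\tau(x)=\langle x\delta_1,\delta_1\rangle$ (where $\delta_1$ is the indicator function of the neutral element) and the norm $\|x\|_2=\tau(x^*x)^{1/2}$; property Gamma means that there is a sequence $(x_n)_{n\in\mathbb{N}}$ of unitary elements of $L\Gamma$ such that $\tau(x_n)=0$ for every $n$, and $\|x_n y-y x_n\|_2\to 0$ as $n\to\infty$ for every $y\in L\Gamma$. -/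

import Mathlib

open scoped ENNReal InnerProductSpace

noncomputable section

/-- A group is ICC if every non-neutral element has an infinite conjugacy class. -/
def IsICC (G : Type*) [Group G] : Prop :=
  ∀ g : G, g ≠ 1 → (conjugatesOf g).Infinite

section Presentation

open Monoid.Coprod in
/-- The group with the presentation `⟨E, t ∣ t a ^ p t⁻¹ = a ^ q⟩`: the quotient of the free product
of `E` with the infinite cyclic group generated by `t`, by the normal closure of the relator
`t a ^ p t⁻¹ (a ^ q)⁻¹`. -/
abbrev OneStableLetterGroup (E : Type*) [Group E] (a : E) (p q : ℤ) : Type _ :=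
  Monoid.Coprod E (Multiplicative ℤ) ⧸
    Subgroup.normalClosure
      ({inr (Multiplicative.ofAdd 1) * inl (a ^ p) * (inr (Multiplicative.ofAdd 1))⁻¹ *
          (inl (a ^ q))⁻¹} : Set (Monoid.Coprod E (Multiplicative ℤ)))

end Presentation

section GroupVonNeumannAlgebra

/-- The Hilbert space `ℓ²(G)` of square-summable complex functions on `G`. -/
abbrev EllTwo (G : Type*) : Type _ := lp (fun _ : G => ℂ) 2

variable {G : Type*} [Group G]

theorem memEllTwo_translate (g : G) (f : EllTwo G) :
    Memℓp (fun h : G => f (g⁻¹ * h)) 2 := by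
  have hf := (memℓp_gen_iff (p := 2) (by norm_num)).1 (lp.memℓp f)
  refine (memℓp_gen_iff (p := 2) (by norm_num)).2 ?_
  exact hf.comp_injective (mul_right_injective g⁻¹)

/-- Left translation by `g` as a linear isometry of `ℓ²(G)`. -/
def leftTranslation (g : G) : EllTwo G →ₗᵢ[ℂ] EllTwo G where
  toFun f := ⟨fun h => f (g⁻¹ * h), memEllTwo_translate g f⟩
  map_add' _ _ := rfl
  map_smul' _ _ := rfl
  norm_map' f := by
    rw [lp.norm_eq_tsum_rpow (by norm_num), lp.norm_eq_tsum_rpow (by norm_num)]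
    congr 1
    exact (Equiv.mulLeft g⁻¹).tsum_eq (fun h => ‖f h‖ ^ (2 : ℝ≥0∞).toReal)

/-- The operator `u_g` of the left regular representation: `(u_g f)(h) = f(g⁻¹ h)`. -/
def leftRegular (g : G) : EllTwo G →L[ℂ] EllTwo G :=
  (leftTranslation g).toContinuousLinearMap

@[simp]
theorem leftRegular_apply (g : G) (f : EllTwo G) (h : G) : leftRegular g f h = f (g⁻¹ * h) := rfl

/-- The von Neumann algebra generated by a set `S` of bounded operators:
the double commutant of `S ∪ S*`. -/
def generatedVonNeumannAlgebra {H : Type*} [NormedAddCommGroup H] [InnerProductSpace ℂ H]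
    [CompleteSpace H] (S : Set (H →L[ℂ] H)) : VonNeumannAlgebra H where
  toStarSubalgebra :=
    StarSubalgebra.centralizer ℂ (StarSubalgebra.centralizer ℂ S : Set (H →L[ℂ] H))
  centralizer_centralizer' := by
    change Set.centralizer (Set.centralizer (StarSubalgebra.centralizer ℂ
      (StarSubalgebra.centralizer ℂ S : Set (H →L[ℂ] H)) : Set (H →L[ℂ] H))) =
      (StarSubalgebra.centralizer ℂ
        (StarSubalgebra.centralizer ℂ S : Set (H →L[ℂ] H)) : Set (H →L[ℂ] H))
    simp

variable (G) in
/-- The group von Neumann algebra `LG`, generated by the unitaries `u_g` on `ℓ²(G)`. -/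
def groupVonNeumannAlgebra : VonNeumannAlgebra (EllTwo G) :=
  generatedVonNeumannAlgebra (Set.range (leftRegular (G := G)))

open Classical in
/-- The canonical trace `τ(x) = ⟪δ₁, x δ₁⟫` of `LG`, where `δ₁` is the indicator of the neutral
element. -/
def groupTrace (x : groupVonNeumannAlgebra G) : ℂ :=
  ⟪(lp.single 2 (1 : G) (1 : ℂ) : EllTwo G),
    (x : EllTwo G →L[ℂ] EllTwo G) (lp.single 2 (1 : G) (1 : ℂ))⟫_ℂ

/-- The norm `‖x‖₂ = τ(x* x) ^ (1/2)` on `LG`; the number `τ(x* x)` is real and nonnegative. -/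
def groupTwoNorm (x : groupVonNeumannAlgebra G) : ℝ :=
  Real.sqrt (groupTrace (star x * x)).re

variable (G) in
/-- Property Gamma of `LG`: there is a sequence of unitaries of `LG` of trace zero that
asymptotically commutes with every element of `LG` in the norm `‖·‖₂`. -/
def GroupVNHasPropertyGamma : Prop :=
  ∃ x : ℕ → groupVonNeumannAlgebra G,
    (∀ n, (x n : EllTwo G →L[ℂ] EllTwo G) ∈ unitary (EllTwo G →L[ℂ] EllTwo G)) ∧
    (∀ n, groupTrace (x n) = 0) ∧
    ∀ y : groupVonNeumannAlgebra G,
      Filter.Tendsto (fun n => groupTwoNorm (x n * y - y * x n)) Filter.atTop (nhds 0)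

end GroupVonNeumannAlgebra

end

/-! ### Normal forms in HNN extensions and centralizers of powers of the stable letter -/

namespace HNNExtension

open NormalWord

variable {G : Type*} [Group G] {A B : Subgroup G} {φ : A ≃* B}

/-! ICC. Γ is the HNN extension of E along a^p ↦ a^q. By pigeonhole, an element g with finite
conjugacy class commutes with a positive power of t and with a positive power of a. A base element
commuting with t^(N+1) must be a power a^c; conjugating N+1 times by t multiplies the exponent by
(q/p)^(N+1) and must return c, so c = 0 since |p| ≠ |q| (`base_eq_one_of_commute_pow`). An induction
on word length then puts the centralizer of t^(N+1) inside ⟨t⟩ (`mem_zpowers_of_commute_pow`). Thus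
g = t^k, and commuting with a power of a forces p^|k| = q^|k|, so k = 0.

Property Gamma. Since a has infinite order, u_a generates a copy of L^∞(ℝ/ℤ), with the trace given
by Haar measure, and conjugation by u_t carries f(pθ) to f(qθ). The unitaries used are x =
exp(iψ(pθ)) evaluated at u_a. They commute with u_e for e in E because a is central, and the
commutator with u_t has 2-norm at most ‖ψ(pθ) − ψ(qθ)‖₂. It remains to find ψ making this small
while exp(iψ(pθ)) has integral zero (`exists_phase_function`).

For this, choose a prime ℓ at which p and q have different valuations. The integers p^i q^(2m−i)
then have distinct ℓ-adic valuations, so the first base-ℓ digits of their multiples of θ are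
independent and uniform (`integral_prod_circleDigit`). Take ψ to be a sum of centred digits with
tent-shaped weights. Passing from pθ to qθ shifts the weights by one place, at a cost of O(1/m) in
variance, while the digit of weight 1 makes the integral vanish.

As ψ is only measurable, x is obtained as a strong limit of continuous functional calculus
(`exists_unitary_of_phase`). Asymptotic commutation then extends from generators of Γ to Γ, and by
2-norm approximation to LΓ (`tendsto_commutator`). -/

theorem isChain_of_forall_fst_eq (u : ℤˣ) (l : List (ℤˣ × G)) (hl : ∀ x ∈ l, x.1 = u) :
    l.IsChain (fun a b => a.2 ∈ toSubgroup A B a.1 → a.1 = b.1) := by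
  induction l with
  | nil => exact List.isChain_nil
  | cons x l ih =>
    refine List.isChain_cons.2 ⟨fun y hy _ => ?_, ih fun y hy => hl y (List.mem_cons_of_mem _ hy)⟩
    rw [hl x List.mem_cons_self, hl y (List.mem_cons_of_mem _ (List.mem_of_mem_head? hy))]

theorem prod_map_replicate (u : ℤˣ) (n : ℕ) :
    ((List.replicate n (u, (1 : G))).map
      (fun x => (t ^ (x.1 : ℤ) * of x.2 : HNNExtension G A B φ))).prod = (t ^ (u : ℤ)) ^ n := by
  simp

/-- A reduced word whose conjugate by a power of the stable letter stays reduced. -/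
theorem exists_reducedWord_conj (s : ℤˣ) (n : ℕ) (w : ReducedWord G A B)
    (hfirst : ∀ x ∈ w.toList.head?, w.head ∈ toSubgroup A B (-s) → x.1 = -s)
    (hlast : ∀ x ∈ w.toList.getLast?, x.2 ∈ toSubgroup A B x.1 → x.1 = s)
    (hnil : w.toList = [] → w.head ∉ toSubgroup A B (-s)) :
    ∃ w' : ReducedWord G A B,
      w'.prod φ = (t ^ (s : ℤ))⁻¹ ^ (n + 1) * w.prod φ * (t ^ (s : ℤ)) ^ (n + 1) ∧
        w'.toList.length = w.toList.length + 2 * (n + 1) := by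
  have hpos : List.IsChain (fun a b : ℤˣ × G => a.2 ∈ toSubgroup A B a.1 → a.1 = b.1)
      (((-s, w.head) :: w.toList) ++ List.replicate (n + 1) (s, 1)) := by
    rw [List.isChain_append]
    refine ⟨List.isChain_cons.2 ⟨fun x hx hm => (hfirst x hx hm).symm, w.chain⟩,
      isChain_of_forall_fst_eq s _ fun x hx => by rw [List.eq_of_mem_replicate hx], ?_⟩
    intro x hx y hy hm
    have hy' : y.1 = s := by rw [List.eq_of_mem_replicate (List.mem_of_mem_head? hy)]
    rw [hy']
    by_cases hw : w.toList = []
    · simp only [hw, List.getLast?_singleton, Option.mem_def, Option.some.injEq] at hx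
      subst hx
      exact absurd hm (hnil hw)
    · refine hlast x ?_ hm
      rw [List.getLast?_cons, List.getLast?_eq_some_getLast hw] at hx
      rw [List.getLast?_eq_some_getLast hw]
      simpa using hx
  -- Only n trivial letters are put in front: the remaining t^(-s) is the one that carries `w.head`.
  refine ⟨⟨1, List.replicate n (-s, 1) ++
    (((-s, w.head) :: w.toList) ++ List.replicate (n + 1) (s, 1)), ?_⟩, ?_, ?_⟩
  · rw [List.isChain_append]
    refine ⟨isChain_of_forall_fst_eq (-s) _ fun x hx => by rw [List.eq_of_mem_replicate hx],
      hpos, ?_⟩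
    intro x hx y hy _
    rw [List.eq_of_mem_replicate (List.mem_of_getLast? hx)]
    simp only [List.cons_append, List.head?_cons, Option.mem_def, Option.some.injEq] at hy
    rw [← hy]
  · simp only [ReducedWord.prod, map_one, one_mul, List.map_append, List.prod_append,
      prod_map_replicate, List.map_cons, List.prod_cons, Units.val_neg, zpow_neg]
    simp only [pow_succ, mul_assoc]
  · simp
    ring

theorem exists_reducedWord_prod_eq (g : HNNExtension G A B φ) :
    ∃ w : ReducedWord G A B, w.prod φ = g := by
  obtain ⟨d⟩ := TransversalPair.nonempty G A B
  refine ⟨((NormalWord.equiv φ d) g).toReducedWord, ?_⟩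
  exact (NormalWord.equiv φ d).symm_apply_apply g

theorem length_eq_of_prod_eq {w₁ w₂ : ReducedWord G A B} (h : w₁.prod φ = w₂.prod φ) :
    w₁.toList.length = w₂.toList.length := by
  simpa using congrArg List.length (ReducedWord.map_fst_eq_and_of_prod_eq φ h).1

theorem commute_pow_units {g : HNNExtension G A B φ} {N : ℕ} (h : Commute g (t ^ N)) (s : ℤˣ) :
    ((t : HNNExtension G A B φ) ^ (s : ℤ))⁻¹ ^ N * g * (t ^ (s : ℤ)) ^ N = g := by
  have : Commute g ((t ^ (s : ℤ)) ^ N) := by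
    rcases Int.units_eq_one_or s with rfl | rfl
    · simpa using h
    · simpa using h.inv_right
  rw [mul_assoc, this.eq, ← mul_assoc, inv_pow, inv_mul_cancel, one_mul]

theorem mem_of_commute_pow {e : G} {N : ℕ}
    (h : Commute (of e : HNNExtension G A B φ) (t ^ (N + 1))) : e ∈ A := by
  by_contra he
  -- The sign is -1 because `toSubgroup A B (-(-1))` is A: for e outside A, the word t^(N+1) e
  -- t^(-(N+1)) is reduced and cannot lie in the base.
  obtain ⟨w', hw', hl⟩ := exists_reducedWord_conj (φ := φ) (-1) N ⟨e, [], List.isChain_nil⟩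
    (by simp) (by simp) (by simpa using he)
  have hp : w'.prod φ = of e := by
    rw [hw', ← commute_pow_units h (-1)]
    simp [ReducedWord.prod]
  have := ReducedWord.toList_eq_nil_of_mem_of_range φ w' ⟨e, hp.symm⟩
  simp [this] at hl

/-- The defining relation turns t^(-s) h t^s into a base element, which absorbs the first letter of
the word. -/
theorem exists_shorter_word (s : ℤˣ) (w : ReducedWord G A B) (x : ℤˣ × G) (l : List (ℤˣ × G))
    (hw : w.toList = x :: l) (hx : x.1 = s) (hm : w.head ∈ toSubgroup A B (-s)) :
    ∃ w' : ReducedWord G A B, w'.prod φ = (t ^ (s : ℤ))⁻¹ * w.prod φ ∧ w'.toList = l := by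
  obtain ⟨h, L, hc⟩ := w
  obtain ⟨u, e⟩ := x
  simp only at hw hx hm
  subst hw hx
  refine ⟨⟨toSubgroupEquiv φ (-u) ⟨h, hm⟩ * e, l, (List.isChain_cons.1 hc).2⟩, ?_, rfl⟩
  have key : (of (toSubgroupEquiv φ (-u) ⟨h, hm⟩ : G) : HNNExtension G A B φ) =
      (t ^ (u : ℤ))⁻¹ * of h * t ^ (u : ℤ) := by
    rcases Int.units_eq_one_or u with rfl | rfl
    · rw [Units.val_one, zpow_one]
      exact equiv_symm_eq_conj (φ := φ) ⟨h, hm⟩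
    · rw [Units.val_neg, Units.val_one, zpow_neg_one, inv_inv]
      exact equiv_eq_conj (φ := φ) ⟨h, hm⟩
  simp only [ReducedWord.prod, map_mul, key, List.map_cons, List.prod_cons]
  group

/-- If no non-neutral element of the base group commutes with `t ^ (N + 1)`, then the centralizer
of `t ^ (N + 1)` consists of powers of `t`. -/
theorem mem_zpowers_of_commute_pow {N : ℕ}
    (hbase : ∀ e : G, Commute (of e : HNNExtension G A B φ) (t ^ (N + 1)) → e = 1)
    {g : HNNExtension G A B φ} (hg : Commute g (t ^ (N + 1))) :
    g ∈ Subgroup.zpowers (t : HNNExtension G A B φ) := by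
  suffices H : ∀ (n : ℕ) (w : ReducedWord G A B), w.toList.length = n →
      Commute (w.prod φ) (t ^ (N + 1)) →
      w.prod φ ∈ Subgroup.zpowers (t : HNNExtension G A B φ) by
    obtain ⟨w, rfl⟩ := exists_reducedWord_prod_eq g
    exact H _ w rfl hg
  intro n
  induction n with
  | zero =>
    intro w hw hc
    have hp : w.prod φ = of w.head := by
      simp [ReducedWord.prod, List.eq_nil_of_length_eq_zero hw]
    rw [hp] at hc ⊢
    simp [hbase _ hc]
  | succ n ih =>
    intro w hw hc
    have hne : w.toList ≠ [] := by
      rintro h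
      simp [h] at hw
    obtain ⟨x, l, hxl⟩ := List.exists_cons_of_ne_nil hne
    -- With s the sign of the last letter, the product with t^(s(N+1)) on the right is automatically
    -- reduced; only the left end of the conjugate can fail to be. If it fails, a factor t^s is
    -- stripped off on the left, which preserves commutation with t^(N+1).
    set s := (w.toList.getLast hne).1 with hs
    by_cases hbad : x.1 = s ∧ w.head ∈ toSubgroup A B (-s)
    · obtain ⟨w', hw', hl⟩ := exists_shorter_word (φ := φ) s w x l hxl hbad.1 hbad.2
      have hcs : Commute ((t : HNNExtension G A B φ) ^ (s : ℤ))⁻¹ (t ^ (N + 1)) :=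
        (((Commute.refl t).zpow_left _).inv_left).pow_right _
      have := ih w' (by rw [hl]; simpa [hxl] using hw) (by rw [hw']; exact hcs.mul_left hc)
      rw [hw'] at this
      exact (Subgroup.mul_mem_cancel_left _ (Subgroup.inv_mem _
        (Subgroup.zpow_mem _ (Subgroup.mem_zpowers _) _))).1 this
    · exfalso
      -- Otherwise the conjugate by a power of t is a strictly longer reduced word with the same
      -- product, against the uniqueness of the length.
      obtain ⟨w', hw', hl⟩ := exists_reducedWord_conj (φ := φ) s N w
        (by
          intro y hy hm
          obtain rfl : x = y := by simpa [hxl] using hy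
          by_contra hne'
          refine hbad ⟨?_, hm⟩
          rw [← neg_neg s]
          exact Int.units_ne_iff_eq_neg.1 hne')
        (by
          intro y hy _
          rw [List.getLast?_eq_some_getLast hne] at hy
          rw [hs, ← Option.some_injective _ hy])
        (fun h => absurd h hne)
      rw [commute_pow_units hc] at hw'
      have := length_eq_of_prod_eq hw'
      omega

end HNNExtension

/-! ### The presented group as an HNN extension, and the ICC property -/

theorem mul_map_zpow_of_conj_eq {E H : Type*} [Group E] [Group H] (f : E →* H) {x : H} {u v : E}
    (h : x * f u * x⁻¹ = f v) (n : ℤ) : x * f (u ^ n) = f (v ^ n) * x := by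
  rw [map_zpow, map_zpow, ← h, conj_zpow]
  simp

theorem zpowersHom_injective {E : Type*} [Group E] {x : E} (hx : ¬ IsOfFinOrder x) :
    Function.Injective (zpowersHom E x) := fun m n h => by
  have := (injective_zpow_iff_not_isOfFinOrder.2 hx) (a₁ := m.toAdd) (a₂ := n.toAdd) (by
    simpa [zpowersHom_apply] using h)
  simpa using this

/-- An element of infinite order generates an infinite cyclic group. -/
noncomputable def zpowersHomRangeEquiv {E : Type*} [Group E] (x : E) (hx : ¬ IsOfFinOrder x) :
    Multiplicative ℤ ≃* (zpowersHom E x).range :=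
  MonoidHom.ofInjective (zpowersHom_injective hx)

/-- The isomorphism of infinite cyclic groups sending the generator `x` to the generator `y`. -/
noncomputable def zpowersRangeEquiv {E : Type*} [Group E] (x y : E) (hx : ¬ IsOfFinOrder x)
    (hy : ¬ IsOfFinOrder y) : (zpowersHom E x).range ≃* (zpowersHom E y).range :=
  (zpowersHomRangeEquiv x hx).symm.trans (zpowersHomRangeEquiv y hy)

theorem zpowersRangeEquiv_apply_zpow {E : Type*} [Group E] (x y : E) (hx : ¬ IsOfFinOrder x)
    (hy : ¬ IsOfFinOrder y) (n : ℤ) (h : x ^ n ∈ (zpowersHom E x).range) :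
    (zpowersRangeEquiv x y hx hy ⟨x ^ n, h⟩ : E) = y ^ n := by
  have : (⟨x ^ n, h⟩ : (zpowersHom E x).range) =
      zpowersHomRangeEquiv x hx (Multiplicative.ofAdd n) := by
    ext
    rw [zpowersHomRangeEquiv, MonoidHom.ofInjective_apply]
    simp
  rw [this, zpowersRangeEquiv, MulEquiv.trans_apply, MulEquiv.symm_apply_apply]
  rw [zpowersHomRangeEquiv, MonoidHom.ofInjective_apply]
  simp

namespace OneStableLetterGroup

variable {E : Type*} [Group E] (a : E) (p q : ℤ)

/-- The canonical map from the base group. -/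
def base : E →* OneStableLetterGroup E a p q :=
  (QuotientGroup.mk' _).comp Monoid.Coprod.inl

/-- The stable letter. -/
def stable : OneStableLetterGroup E a p q :=
  QuotientGroup.mk' _ (Monoid.Coprod.inr (Multiplicative.ofAdd 1))

theorem stable_mul_base_mul_inv :
    stable a p q * base a p q (a ^ p) * (stable a p q)⁻¹ = base a p q (a ^ q) := by
  rw [← mul_inv_eq_one]
  exact (QuotientGroup.eq_one_iff _).2 (Subgroup.subset_normalClosure rfl)

variable {a p q} in
theorem hom_ext {M : Type*} [Monoid M] {f g : OneStableLetterGroup E a p q →* M}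
    (hb : f.comp (base a p q) = g.comp (base a p q)) (hs : f (stable a p q) = g (stable a p q)) :
    f = g := by
  refine QuotientGroup.monoidHom_ext _ (Monoid.Coprod.hom_ext hb ?_)
  ext
  exact hs

/-- The universal property of the presentation. -/
def lift {H : Type*} [Group H] (f : E →* H) (x : H) (hx : x * f (a ^ p) * x⁻¹ = f (a ^ q)) :
    OneStableLetterGroup E a p q →* H :=
  QuotientGroup.lift _ (Monoid.Coprod.lift f (zpowersHom H x)) (by
    refine Subgroup.normalClosure_le_normal (N := MonoidHom.ker _) ?_
    rintro _ rfl
    rw [SetLike.mem_coe, MonoidHom.mem_ker]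
    simp only [map_mul, map_inv, Monoid.Coprod.lift_apply_inl, Monoid.Coprod.lift_apply_inr,
      zpowersHom_apply, toAdd_ofAdd, zpow_one]
    rw [hx, mul_inv_cancel])

@[simp]
theorem lift_base {H : Type*} [Group H] (f : E →* H) (x : H)
    (hx : x * f (a ^ p) * x⁻¹ = f (a ^ q)) (e : E) : lift a p q f x hx (base a p q e) = f e := by
  change QuotientGroup.lift _ (Monoid.Coprod.lift f (zpowersHom H x)) _
    (QuotientGroup.mk (Monoid.Coprod.inl e)) = f e
  rw [QuotientGroup.lift_mk, Monoid.Coprod.lift_apply_inl]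

@[simp]
theorem lift_stable {H : Type*} [Group H] (f : E →* H) (x : H)
    (hx : x * f (a ^ p) * x⁻¹ = f (a ^ q)) : lift a p q f x hx (stable a p q) = x := by
  change QuotientGroup.lift _ (Monoid.Coprod.lift f (zpowersHom H x)) _
    (QuotientGroup.mk (Monoid.Coprod.inr (Multiplicative.ofAdd 1))) = x
  rw [QuotientGroup.lift_mk, Monoid.Coprod.lift_apply_inr]
  simp

/-- The universal property maps the whole group into the subgroup K generated by these elements;
followed by the inclusion of K this is the identity on generators, so K is everything. -/
theorem closure_base_union_stable :
    Subgroup.closure (Set.range (base a p q) ∪ {stable a p q}) = ⊤ := by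
  set K := Subgroup.closure (Set.range (base a p q) ∪ {stable a p q}) with hK
  have hb (e : E) : base a p q e ∈ K := Subgroup.subset_closure (Or.inl ⟨e, rfl⟩)
  have hs : stable a p q ∈ K := Subgroup.subset_closure (Or.inr rfl)
  let f : OneStableLetterGroup E a p q →* K :=
    lift a p q ((base a p q).codRestrict K hb) ⟨stable a p q, hs⟩ (by
      ext
      exact stable_mul_base_mul_inv a p q)
  have hf : K.subtype.comp f = MonoidHom.id _ := hom_ext (by ext; simp [f]) (by simp [f])
  rw [eq_top_iff]
  intro x _
  have := DFunLike.congr_fun hf x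
  rw [MonoidHom.id_apply] at this
  rw [← this]
  exact (f x).2

variable {a p q}

theorem not_isOfFinOrder_zpow (ha : ¬ IsOfFinOrder a) (hp : p ≠ 0) : ¬ IsOfFinOrder (a ^ p) := by
  intro h
  rw [isOfFinOrder_iff_zpow_eq_one] at h
  obtain ⟨n, hn, h⟩ := h
  rw [← zpow_mul] at h
  exact ha (isOfFinOrder_iff_zpow_eq_one.2 ⟨p * n, mul_ne_zero hp hn, h⟩)

/-- The group `⟨E, t ∣ t a ^ p t⁻¹ = a ^ q⟩` is an HNN extension of `E`. -/
noncomputable def equivHNNExtension (ha : ¬ IsOfFinOrder a) (hp : p ≠ 0) (hq : q ≠ 0) :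
    OneStableLetterGroup E a p q ≃* HNNExtension E (zpowersHom E (a ^ p)).range
      (zpowersHom E (a ^ q)).range (zpowersRangeEquiv (a ^ p) (a ^ q)
        (not_isOfFinOrder_zpow ha hp) (not_isOfFinOrder_zpow ha hq)) :=
  MonoidHom.toMulEquiv
    (lift a p q HNNExtension.of HNNExtension.t (by
      have hm : (a ^ p) ^ (1 : ℤ) ∈ (zpowersHom E (a ^ p)).range :=
        ⟨Multiplicative.ofAdd 1, by simp⟩
      have h := HNNExtension.equiv_eq_conj (φ := zpowersRangeEquiv (a ^ p) (a ^ q)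
        (not_isOfFinOrder_zpow ha hp) (not_isOfFinOrder_zpow ha hq)) ⟨(a ^ p) ^ (1 : ℤ), hm⟩
      rw [zpowersRangeEquiv_apply_zpow] at h
      simpa only [zpow_one] using h.symm))
    (HNNExtension.lift (base a p q) (stable a p q) (by
      rintro ⟨_, n, rfl⟩
      have h : (zpowersHom E (a ^ p)) n = (a ^ p) ^ n.toAdd := by simp
      simp only [h, zpowersRangeEquiv_apply_zpow]
      exact mul_map_zpow_of_conj_eq _ (stable_mul_base_mul_inv a p q) _))
    (hom_ext (by ext; simp) (by simp))
    (HNNExtension.hom_ext (by ext; simp) (by simp))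

/-- The base group embeds in the HNN extension. In particular a keeps infinite order in Γ. -/
theorem base_injective (ha : ¬ IsOfFinOrder a) (hp : p ≠ 0) (hq : q ≠ 0) :
    Function.Injective (base a p q) := by
  have : (equivHNNExtension ha hp hq) ∘ base a p q = HNNExtension.of := by
    ext x
    simp [equivHNNExtension]
  refine Function.Injective.of_comp (f := equivHNNExtension ha hp hq) ?_
  rw [this]
  exact HNNExtension.of_injective _

theorem stable_mul_base_zpow (n : ℤ) :
    stable a p q * base a p q (a ^ (p * n)) = base a p q (a ^ (q * n)) * stable a p q := by
  rw [zpow_mul, zpow_mul]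
  exact mul_map_zpow_of_conj_eq _ (stable_mul_base_mul_inv a p q) _

theorem stable_pow_mul_base_zpow (k : ℕ) (n : ℤ) :
    stable a p q ^ k * base a p q (a ^ (p ^ k * n)) =
      base a p q (a ^ (q ^ k * n)) * stable a p q ^ k := by
  induction k generalizing n with
  | zero => simp
  | succ k ih =>
    rw [pow_succ, mul_assoc, show p ^ (k + 1) * n = p * (p ^ k * n) by ring,
      stable_mul_base_zpow, ← mul_assoc, show q * (p ^ k * n) = p ^ k * (q * n) by ring, ih,
      mul_assoc, show q ^ k * (q * n) = q ^ (k + 1) * n by ring]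

theorem eq_zero_of_pow_eq_pow (hpq : |p| ≠ |q|) {k : ℕ} (h : p ^ k = q ^ k) : k = 0 := by
  by_contra hk
  apply hpq
  have := congrArg abs h
  rw [abs_pow, abs_pow] at this
  exact (pow_left_inj₀ (abs_nonneg p) (abs_nonneg q) hk).1 this

/-- No non-neutral element of the base group commutes with a power of the stable letter. -/
theorem base_eq_one_of_commute_pow (ha : ¬ IsOfFinOrder a) (hp : p ≠ 0) (hq : q ≠ 0)
    (hpq : |p| ≠ |q|) {N : ℕ} {e : E}
    (he : Commute (base a p q e) (stable a p q ^ (N + 1))) : e = 1 := by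
  have hmem (e : E) (he : Commute (base a p q e) (stable a p q ^ (N + 1))) :
      ∃ m : ℤ, e = a ^ (p * m) := by
    have h := he.map (equivHNNExtension ha hp hq)
    simp only [map_pow] at h
    have h1 : equivHNNExtension ha hp hq (base a p q e) = HNNExtension.of e := by
      simp [equivHNNExtension]
    have h2 : equivHNNExtension ha hp hq (stable a p q) = HNNExtension.t := by
      simp [equivHNNExtension]
    rw [h1, h2] at h
    obtain ⟨m, hm⟩ := HNNExtension.mem_of_commute_pow h
    exact ⟨m.toAdd, by rw [← hm, zpow_mul]; simp⟩
  have hinj := injective_zpow_iff_not_isOfFinOrder.2 ha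
  obtain ⟨m₀, rfl⟩ := hmem e he
  -- Here a^c is t^k e t^(-k). The iteration continues because this element again commutes with
  -- t^(N+1), hence its exponent is again a multiple of p.
  have key (k : ℕ) : ∃ c : ℤ, p ^ k * c = q ^ k * (p * m₀) ∧
      stable a p q ^ k * base a p q (a ^ (p * m₀)) = base a p q (a ^ c) * stable a p q ^ k := by
    induction k with
    | zero => exact ⟨p * m₀, by simp⟩
    | succ k ih =>
      obtain ⟨c, hc, h⟩ := ih
      have hcomm : Commute (base a p q (a ^ c)) (stable a p q ^ (N + 1)) := by
        rw [eq_mul_inv_of_mul_eq h.symm]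
        have hs : Commute (stable a p q ^ k) (stable a p q ^ (N + 1)) :=
          Commute.pow_pow_self _ _ _
        exact (hs.mul_left he).mul_left hs.inv_left
      obtain ⟨m, hm⟩ := hmem _ hcomm
      obtain rfl : c = p * m := hinj hm
      refine ⟨q * m, by linear_combination q * hc, ?_⟩
      rw [pow_succ', mul_assoc, h, ← mul_assoc, stable_mul_base_zpow, mul_assoc]
  -- Conjugation by t^(N+1) fixes e, so the exponent is unchanged; either it is zero or p^(N+1) =
  -- q^(N+1).
  obtain ⟨c, hc, h⟩ := key (N + 1)
  rw [← he.eq] at h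
  obtain rfl : p * m₀ = c := hinj (base_injective ha hp hq (mul_right_cancel h))
  rw [mul_eq_mul_right_iff] at hc
  rcases hc with hc | hc
  · exact absurd (eq_zero_of_pow_eq_pow hpq hc) (Nat.succ_ne_zero N)
  · simp [hc]

/-- Among the conjugates of g by the powers of x two coincide; the difference of the exponents is N
+ 1. -/
theorem exists_commute_pow_of_finite_conjugatesOf {G : Type*} [Group G] {g : G}
    (h : (conjugatesOf g).Finite) (x : G) : ∃ N : ℕ, Commute g (x ^ (N + 1)) := by
  have hm : Set.MapsTo (fun n : ℕ => x ^ n * g * (x ^ n)⁻¹) Set.univ (conjugatesOf g) :=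
    fun n _ => isConj_iff.2 ⟨x ^ n, rfl⟩
  obtain ⟨i, -, j, -, hij, he⟩ := Set.infinite_univ.exists_lt_map_eq_of_mapsTo hm h
  obtain ⟨N, rfl⟩ := Nat.exists_eq_add_of_lt hij
  refine ⟨N, ?_⟩
  rw [add_assoc, pow_add] at he
  have : g = x ^ (N + 1) * g * (x ^ (N + 1))⁻¹ := by
    have h1 : x ^ i * g * (x ^ i)⁻¹ = x ^ i * (x ^ (N + 1) * g * (x ^ (N + 1))⁻¹) * (x ^ i)⁻¹ := by
      rw [he]; group
    exact mul_left_cancel (mul_right_cancel h1)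
  rw [Commute, SemiconjBy]
  exact eq_mul_inv_iff_mul_eq.1 this

theorem isICC (ha : ¬ IsOfFinOrder a) (hp : p ≠ 0) (hq : q ≠ 0) (hpq : |p| ≠ |q|) :
    IsICC (OneStableLetterGroup E a p q) := by
  intro g hg hfin
  apply hg
  obtain ⟨N, hN⟩ := exists_commute_pow_of_finite_conjugatesOf hfin (stable a p q)
  obtain ⟨M, hM⟩ := exists_commute_pow_of_finite_conjugatesOf hfin (base a p q a)
  have h1 (e : E) : equivHNNExtension ha hp hq (base a p q e) = HNNExtension.of e := by
    simp [equivHNNExtension]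
  have h2 : equivHNNExtension ha hp hq (stable a p q) = HNNExtension.t := by
    simp [equivHNNExtension]
  obtain ⟨k, hk⟩ := HNNExtension.mem_zpowers_of_commute_pow (N := N) (fun e he => by
    refine base_eq_one_of_commute_pow ha hp hq hpq (N := N) (e := e) ?_
    rw [← h1, ← h2, ← map_pow] at he
    exact (commute_map_iff (equivHNNExtension ha hp hq).injective).1 he)
    (g := equivHNNExtension ha hp hq g) (by
      rw [← h2, ← map_pow]
      exact hN.map _)
  obtain rfl : stable a p q ^ k = g := by
    apply (equivHNNExtension ha hp hq).injective
    rw [map_zpow (equivHNNExtension ha hp hq), h2]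
    exact hk
  have hc : Commute (stable a p q ^ k.natAbs) (base a p q a ^ (M + 1)) := by
    rcases Int.natAbs_eq k with h | h
    · rw [← zpow_natCast, ← h]
      exact hM
    · rw [← zpow_natCast, ← neg_eq_iff_eq_neg.2 h, zpow_neg]
      exact hM.inv_left
  have h3 := stable_pow_mul_base_zpow (a := a) (p := p) (q := q) k.natAbs (M + 1)
  -- Raising to the power p^|k| makes the exponent divisible enough for conjugation by t^|k| to be
  -- computable: it replaces p^|k| by q^|k|, yet must change nothing.
  have h4 : Commute (stable a p q ^ k.natAbs) (base a p q (a ^ (p ^ k.natAbs * (M + 1)))) := by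
    rw [show p ^ k.natAbs * ((M : ℤ) + 1) = ((M + 1 : ℕ) : ℤ) * p ^ k.natAbs by push_cast; ring,
      zpow_mul, zpow_natCast, map_zpow (base a p q) (a ^ (M + 1)), map_pow (base a p q) a]
    exact hc.zpow_right _
  rw [h4.eq] at h3
  have h5 := injective_zpow_iff_not_isOfFinOrder.2 ha
    (base_injective ha hp hq (mul_right_cancel h3))
  rw [mul_left_inj' (by positivity)] at h5
  have := eq_zero_of_pow_eq_pow hpq h5
  simp [Int.natAbs_eq_zero.1 this]

end OneStableLetterGroup

/-! ### Independent digits on the circle and the phase function -/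

section Circle

open MeasureTheory AddCircle

/-- The first digit in base `ℓ` of a point of the circle `ℝ / ℤ`. -/
noncomputable def circleDigit (ℓ : ℕ) [NeZero ℓ] : UnitAddCircle → ZMod ℓ :=
  Function.Periodic.lift (f := fun x : ℝ => ((⌊ℓ * x⌋ : ℤ) : ZMod ℓ)) (c := 1) fun x => by
    have : (ℓ : ℝ) * (x + 1) = ℓ * x + (ℓ : ℤ) := by push_cast; ring
    simp [this]

section Digit

variable (ℓ : ℕ) [NeZero ℓ]

theorem circleDigit_coe (x : ℝ) : circleDigit ℓ (x : UnitAddCircle) = (⌊ℓ * x⌋ : ℤ) := rfl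

theorem circleDigit_add_div (θ : UnitAddCircle) (m : ℤ) :
    circleDigit ℓ (θ + ((m / ℓ : ℝ) : UnitAddCircle)) = circleDigit ℓ θ + m := by
  induction θ using QuotientAddGroup.induction_on with
  | H x =>
    rw [← AddCircle.coe_add, circleDigit_coe]
    have hℓ : (ℓ : ℝ) ≠ 0 := Nat.cast_ne_zero.2 (NeZero.ne ℓ)
    have : (ℓ : ℝ) * (x + m / ℓ) = ℓ * x + m := by field_simp
    rw [this, Int.floor_add_intCast]
    push_cast
    rfl

theorem measurable_circleDigit : Measurable (circleDigit ℓ) := by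
  refine QuotientAddGroup.measurable_from_quotient.2 ?_
  change Measurable fun x : ℝ => ((⌊ℓ * x⌋ : ℤ) : ZMod ℓ)
  exact (measurable_of_countable _).comp (Int.measurable_floor.comp (measurable_const_mul _))

theorem measurable_comp_circleDigit_zsmul {X : Type*} [MeasurableSpace X] (H : ZMod ℓ → X)
    (N : ℤ) : Measurable fun θ : UnitAddCircle => H (circleDigit ℓ (N • θ)) :=
  (measurable_of_countable H).comp
    ((measurable_circleDigit ℓ).comp (continuous_zsmul N).measurable)

theorem norm_prod_circleDigit_le {ι 𝕜 : Type*} [RCLike 𝕜] (s : Finset ι) (N : ι → ℤ)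
    (H : ι → ZMod ℓ → 𝕜) (θ : UnitAddCircle) :
    ‖∏ i ∈ s, H i (circleDigit ℓ (N i • θ))‖ ≤ ∏ i ∈ s, ∑ j, ‖H i j‖ := by
  rw [norm_prod]
  exact Finset.prod_le_prod (fun _ _ => norm_nonneg _) fun i _ =>
    Finset.single_le_sum (f := fun j => ‖H i j‖) (fun _ _ => norm_nonneg _) (Finset.mem_univ _)

theorem integrable_prod_circleDigit {ι 𝕜 : Type*} [RCLike 𝕜] (s : Finset ι) (N : ι → ℤ)
    (H : ι → ZMod ℓ → 𝕜) :
    Integrable (fun θ : UnitAddCircle => ∏ i ∈ s, H i (circleDigit ℓ (N i • θ)))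
      haarAddCircle :=
  Integrable.of_bound (Finset.measurable_fun_prod s fun i _ =>
    measurable_comp_circleDigit_zsmul ℓ (H i) (N i)).aestronglyMeasurable _
    (Filter.Eventually.of_forall (norm_prod_circleDigit_le ℓ s N H))

variable [Fact ℓ.Prime]

/-- The base-`ℓ` digits of the multiples of a uniformly distributed point by integers of distinct
`ℓ`-adic valuations are independent and uniformly distributed. -/
theorem integral_prod_circleDigit {ι 𝕜 : Type*} [RCLike 𝕜] (s : Finset ι) (N : ι → ℤ)
    (v : ι → ℕ) (M : ι → ℤ) (hN : ∀ i, N i = (ℓ : ℤ) ^ v i * M i) (hM : ∀ i, ¬ (ℓ : ℤ) ∣ M i)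
    (hv : Set.InjOn v s) (H : ι → ZMod ℓ → 𝕜) :
    ∫ θ : UnitAddCircle, ∏ i ∈ s, H i (circleDigit ℓ (N i • θ)) ∂haarAddCircle =
      ∏ i ∈ s, ((ℓ : 𝕜)⁻¹ * ∑ j, H i j) := by
  classical
  have hℓ : (ℓ : 𝕜) ≠ 0 := Nat.cast_ne_zero.2 (NeZero.ne ℓ)
  have hℓ' : (ℓ : ℝ) ≠ 0 := Nat.cast_ne_zero.2 (NeZero.ne ℓ)
  induction s using Finset.induction_on_min_value v with
  | empty => simp
  | insert b s hb hmin ih =>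
    rw [Finset.prod_insert hb, ← ih (hv.mono (by simp))]
    have hlt : ∀ i ∈ s, v b + 1 ≤ v i := fun i hi =>
      lt_of_le_of_ne (hmin i hi) fun h =>
        hb (hv (by simp) (by simp [hi]) h ▸ hi)
    -- The index b has the least valuation. Rotation by j / ℓ^(v b + 1) shifts its digit by j * M b
    -- and fixes the multiples by all other N i, whose valuations are at least v b + 1. Averaging
    -- over j replaces the factor of b by its mean.
    let r (j : ZMod ℓ) : UnitAddCircle := ((j.val / (ℓ : ℝ) ^ (v b + 1) : ℝ) : UnitAddCircle)
    have hrot (j : ZMod ℓ) (θ : UnitAddCircle) :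
        ∏ i ∈ insert b s, H i (circleDigit ℓ (N i • (θ + r j))) =
          H b (circleDigit ℓ (N b • θ) + j * (M b : ZMod ℓ)) *
            ∏ i ∈ s, H i (circleDigit ℓ (N i • θ)) := by
      rw [Finset.prod_insert hb]
      congr 1
      · have : N b • r j = (((j.val * M b : ℤ) / ℓ : ℝ) : UnitAddCircle) := by
          rw [← AddCircle.coe_zsmul, hN b]
          congr 1
          rw [zsmul_eq_mul]
          push_cast
          field_simp
          ring
        rw [smul_add, this, circleDigit_add_div]
        simp
      · refine Finset.prod_congr rfl fun i hi => ?_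
        have : N i • r j = 0 := by
          rw [← AddCircle.coe_zsmul, AddCircle.coe_eq_zero_iff]
          obtain ⟨c, hc⟩ := Nat.exists_eq_add_of_le (hlt i hi)
          refine ⟨(ℓ : ℤ) ^ c * M i * j.val, ?_⟩
          rw [hN i, hc]
          simp only [zsmul_eq_mul, pow_add]
          push_cast
          field_simp
        rw [smul_add, this, add_zero]
    have hshift (j : ZMod ℓ) :
        ∫ θ : UnitAddCircle, ∏ i ∈ insert b s, H i (circleDigit ℓ (N i • θ)) ∂haarAddCircle =
          ∫ θ : UnitAddCircle, H b (circleDigit ℓ (N b • θ) + j * (M b : ZMod ℓ)) *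
            ∏ i ∈ s, H i (circleDigit ℓ (N i • θ)) ∂haarAddCircle := by
      rw [← integral_add_right_eq_self _ (r j)]
      simp_rw [hrot]
    have hint (j : ZMod ℓ) : Integrable (fun θ : UnitAddCircle =>
        H b (circleDigit ℓ (N b • θ) + j * (M b : ZMod ℓ)) *
          ∏ i ∈ s, H i (circleDigit ℓ (N i • θ))) haarAddCircle := by
      have := (integrable_prod_circleDigit ℓ (insert b s) N H).comp_add_right (r j)
      simpa only [hrot] using this
    have hM' : (M b : ZMod ℓ) ≠ 0 := fun h => hM b ((ZMod.intCast_zmod_eq_zero_iff_dvd _ _).1 h)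
    -- As ℓ is prime and does not divide M b, the map j ↦ d + j * M b permutes the residues.
    have hsum (d : ZMod ℓ) : ∑ j, H b (d + j * (M b : ZMod ℓ)) = ∑ j, H b j :=
      Fintype.sum_equiv ((Equiv.mulRight₀ _ hM').trans (Equiv.addLeft d)) _ _ fun j => rfl
    have hcard : (ℓ : 𝕜) * ∫ θ : UnitAddCircle,
          ∏ i ∈ insert b s, H i (circleDigit ℓ (N i • θ)) ∂haarAddCircle =
        (∑ j, H b j) *
          ∫ θ : UnitAddCircle, ∏ i ∈ s, H i (circleDigit ℓ (N i • θ)) ∂haarAddCircle := by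
      have h1 : (ℓ : 𝕜) * ∫ θ : UnitAddCircle,
          ∏ i ∈ insert b s, H i (circleDigit ℓ (N i • θ)) ∂haarAddCircle =
          ∑ _j : ZMod ℓ, ∫ θ : UnitAddCircle,
            ∏ i ∈ insert b s, H i (circleDigit ℓ (N i • θ)) ∂haarAddCircle := by
        simp [ZMod.card]
      rw [h1, Finset.sum_congr rfl fun j _ => hshift j, ← integral_finsetSum _ fun j _ => hint j,
        ← integral_const_mul]
      simp_rw [← Finset.sum_mul, hsum]
    rw [mul_assoc, ← hcard, inv_mul_cancel_left₀ hℓ]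

/-- Variance of a sum of independent variables: the cross terms vanish because g is centred. -/
theorem integral_sq_sum_circleDigit {ι : Type*} (s : Finset ι) (N : ι → ℤ)
    (v : ι → ℕ) (M : ι → ℤ) (hN : ∀ i, N i = (ℓ : ℤ) ^ v i * M i) (hM : ∀ i, ¬ (ℓ : ℤ) ∣ M i)
    (hv : Set.InjOn v s) (c : ι → ℝ) (g : ZMod ℓ → ℝ) (hg : ∑ j, g j = 0) :
    ∫ θ : UnitAddCircle, (∑ i ∈ s, c i * g (circleDigit ℓ (N i • θ))) ^ 2 ∂haarAddCircle =
      (∑ i ∈ s, c i ^ 2) * ((ℓ : ℝ)⁻¹ * ∑ j, g j ^ 2) := by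
  classical
  have hterm (i k : ι) (hi : i ∈ s) (hk : k ∈ s) : ∫ θ : UnitAddCircle,
      (c i * g (circleDigit ℓ (N i • θ))) * (c k * g (circleDigit ℓ (N k • θ))) ∂haarAddCircle =
      if i = k then c i ^ 2 * ((ℓ : ℝ)⁻¹ * ∑ j, g j ^ 2) else 0 := by
    split_ifs with h
    · subst h
      have := integral_prod_circleDigit ℓ {i} N v M hN hM (by simp) fun _ j => (c i * g j) ^ 2
      simp only [Finset.prod_singleton] at this
      simp_rw [← sq, this, mul_pow, ← Finset.mul_sum]
      ring
    · have := integral_prod_circleDigit ℓ {i, k} N v M hN hM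
        (hv.mono (by simp [Set.insert_subset_iff, hi, hk])) fun a j => c a * g j
      simp only [Finset.prod_pair h] at this
      rw [this, ← Finset.mul_sum, hg]
      simp
  have hint (i k : ι) : Integrable (fun θ : UnitAddCircle =>
      (c i * g (circleDigit ℓ (N i • θ))) * (c k * g (circleDigit ℓ (N k • θ))))
        haarAddCircle := by
    -- Indexing by `Fin 2` keeps both factors when i = k; a product over {i, k} would lose one.
    have := integrable_prod_circleDigit ℓ (Finset.univ : Finset (Fin 2)) ![N i, N k]
      (![fun j => c i * g j, fun j => c k * g j] : Fin 2 → ZMod ℓ → ℝ)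
    simpa [Fin.prod_univ_two] using this
  simp_rw [sq (Finset.sum _ _), Finset.sum_mul_sum]
  rw [integral_finsetSum _ fun i _ => integrable_finsetSum _ fun k _ => hint i k, Finset.sum_mul]
  refine Finset.sum_congr rfl fun i hi => ?_
  rw [integral_finsetSum _ fun k _ => hint i k,
    Finset.sum_congr rfl fun k hk => hterm i k hi hk]
  simp [hi]

end Digit

/-- Two non-zero integers of distinct absolute values are distinguished by some valuation. -/
theorem exists_prime_valuation_ne {p q : ℤ} (hp : p ≠ 0) (hq : q ≠ 0) (hpq : |p| ≠ |q|) :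
    ∃ (ℓ : ℕ) (_ : ℓ.Prime) (u v : ℕ) (p' q' : ℤ), u ≠ v ∧ p = (ℓ : ℤ) ^ u * p' ∧
      q = (ℓ : ℤ) ^ v * q' ∧ ¬ (ℓ : ℤ) ∣ p' ∧ ¬ (ℓ : ℤ) ∣ q' := by
  have hne : p.natAbs ≠ q.natAbs := fun h => hpq (by
    rw [Int.abs_eq_natAbs, Int.abs_eq_natAbs, h])
  obtain ⟨ℓ, hℓ⟩ : ∃ ℓ, p.natAbs.factorization ℓ ≠ q.natAbs.factorization ℓ := by
    by_contra! h
    exact hne (Nat.eq_of_factorization_eq (Int.natAbs_ne_zero.2 hp) (Int.natAbs_ne_zero.2 hq) h)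
  have hprime : ℓ.Prime := by
    by_contra h
    simp [Nat.factorization_eq_zero_of_not_prime _ h] at hℓ
  have hfin (x : ℤ) (hx : x ≠ 0) : FiniteMultiplicity (ℓ : ℤ) x :=
    Int.finiteMultiplicity_iff.2 ⟨by simpa using hprime.ne_one, hx⟩
  obtain ⟨p', hp', hp''⟩ := (hfin p hp).exists_eq_pow_mul_and_not_dvd
  obtain ⟨q', hq', hq''⟩ := (hfin q hq).exists_eq_pow_mul_and_not_dvd
  have hmul (x : ℤ) (hx : x ≠ 0) : multiplicity (ℓ : ℤ) x = x.natAbs.factorization ℓ := by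
    rw [Nat.factorization_def _ hprime, padicValNat_def' hprime.ne_one (Int.natAbs_ne_zero.2 hx),
      Int.multiplicity_natAbs]
  refine ⟨ℓ, hprime, _, _, p', q', ?_, hp', hq', hp'', hq''⟩
  rwa [hmul p hp, hmul q hq]

/-- There are phase functions `ψ` on the circle that take almost the same value at `p θ` and at
`q θ`, while `exp (i ψ (p θ))` has mean zero. -/
theorem exists_phase_function {p q : ℤ} (hp : p ≠ 0) (hq : q ≠ 0) (hpq : |p| ≠ |q|) {ε : ℝ}
    (hε : 0 < ε) : ∃ ψ : UnitAddCircle → ℝ, Measurable ψ ∧ (∃ C, ∀ θ, |ψ θ| ≤ C) ∧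
      ∫ θ : UnitAddCircle, Complex.exp (Complex.I * ψ (p • θ)) ∂haarAddCircle = 0 ∧
      ∫ θ : UnitAddCircle, (ψ (p • θ) - ψ (q • θ)) ^ 2 ∂haarAddCircle ≤ ε := by
  obtain ⟨ℓ, hℓ, u, v, p', q', huv, hp', hq', hpd, hqd⟩ := exists_prime_valuation_ne hp hq hpq
  have : Fact ℓ.Prime := ⟨hℓ⟩
  have : NeZero ℓ := ⟨hℓ.ne_zero⟩
  have hℓ0 : (ℓ : ℝ) ≠ 0 := Nat.cast_ne_zero.2 hℓ.ne_zero
  let κ : ℝ := (ℓ : ℝ)⁻¹ * ∑ j : ZMod ℓ, 2 * Real.pi * j.val / ℓ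
  -- The argument of a primitive additive character of ℤ/ℓ, centred by κ. Centring gives
  -- orthogonality, and exp(i g) still sums to zero, being a constant multiple of a nontrivial
  -- character.
  let g (j : ZMod ℓ) : ℝ := 2 * Real.pi * j.val / ℓ - κ
  have hg : ∑ j, g j = 0 := by
    simp only [g, Finset.sum_sub_distrib, Finset.sum_const, Finset.card_univ, ZMod.card,
      nsmul_eq_mul, κ]
    rw [mul_inv_cancel_left₀ hℓ0, sub_self]
  have hexp : ∑ j, Complex.exp (Complex.I * g j) = 0 := by
    have h1 (j : ZMod ℓ) : Complex.exp (Complex.I * g j) =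
        ZMod.stdAddChar j * Complex.exp (-(Complex.I * κ)) := by
      rw [ZMod.stdAddChar_apply, ZMod.toCircle_apply, ← Complex.exp_add]
      congr 1
      simp only [g]
      push_cast
      ring
    have : Fact (1 < ℓ) := ⟨hℓ.one_lt⟩
    simp_rw [h1, ← Finset.sum_mul]
    rw [AddChar.sum_eq_zero_of_ne_one, zero_mul]
    intro h
    have := ZMod.injective_stdAddChar (N := ℓ) (a₁ := 1) (a₂ := 0) (by simp [h])
    exact one_ne_zero this
  set V : ℝ := (ℓ : ℝ)⁻¹ * ∑ j, g j ^ 2 with hV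
  have hV0 : 0 ≤ V := by positivity
  -- The final bound will be 2V/m: 2m weight increments, each of square at most 1/m², times the
  -- variance V of one digit.
  obtain ⟨k, hk⟩ := exists_nat_gt (2 * V / ε)
  let m : ℕ := k + 1
  have hm0 : (0 : ℝ) < m := by positivity
  have hmV : 2 * V / m ≤ ε := by
    rw [div_le_iff₀ hm0]
    rw [div_lt_iff₀ hε] at hk
    have : (k : ℝ) ≤ m := by simp [m]
    nlinarith
  -- Tent of slope 1/m on 0, ..., 2m: it vanishes at both ends, and its value 1 at m will make the
  -- exponential integrate to zero.
  let w (i : ℕ) : ℝ := 1 - |(i : ℝ) - m| / m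
  have hw0 : w 0 = 0 := by
    simp [w, abs_of_pos hm0, hm0.ne']
  have hwm : w m = 1 := by simp [w]
  have hw2 : w (2 * m) = 0 := by
    have : ((2 * m : ℕ) : ℝ) - m = m := by push_cast; ring
    simp only [w, this, abs_of_pos hm0, div_self hm0.ne', sub_self]
  have hwd (i : ℕ) : (w i - w (i + 1)) ^ 2 ≤ 1 / (m : ℝ) ^ 2 := by
    have h1 : w i - w (i + 1) = (|((i + 1 : ℕ) : ℝ) - m| - |(i : ℝ) - m|) / m := by
      simp only [w]; ring
    rw [h1, div_pow]
    gcongr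
    rw [sq_le_one_iff_abs_le_one]
    refine (abs_abs_sub_abs_le_abs_sub _ _).trans ?_
    push_cast
    simp
  let N (i : ℕ) : ℤ := p ^ i * q ^ (2 * m - i)
  let vN (i : ℕ) : ℕ := u * i + v * (2 * m - i)
  let MN (i : ℕ) : ℤ := p' ^ i * q' ^ (2 * m - i)
  have hpr : Prime (ℓ : ℤ) := Nat.prime_iff_prime_int.1 hℓ
  have hN (i : ℕ) : N i = (ℓ : ℤ) ^ vN i * MN i := by
    simp only [N, vN, MN, pow_add, pow_mul]
    conv_lhs => rw [hp', hq']
    ring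
  have hMN (i : ℕ) : ¬ (ℓ : ℤ) ∣ MN i := fun h => by
    rcases hpr.dvd_or_dvd h with h | h
    · exact hpd (hpr.dvd_of_dvd_pow h)
    · exact hqd (hpr.dvd_of_dvd_pow h)
  have hvN : Set.InjOn vN (Set.Iic (2 * m)) := by
    intro i hi j hj hij
    rw [Set.mem_Iic] at hi hj
    simp only [vN] at hij
    zify [hi, hj] at hij
    have : ((u : ℤ) - v) * (i - j) = 0 := by linear_combination hij
    rcases mul_eq_zero.1 this with h | h
    · exact absurd (by exact_mod_cast sub_eq_zero.1 h) huv
    · exact_mod_cast sub_eq_zero.1 h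
  -- ψ is built from K, whose multiples by p and by q are consecutive terms of N.
  let K (i : ℕ) : ℤ := p ^ i * q ^ (2 * m - 1 - i)
  have hKp (i : ℕ) (hi : i ∈ Finset.range (2 * m)) : K i * p = N (i + 1) := by
    simp only [K, N, show 2 * m - (i + 1) = 2 * m - 1 - i by omega]
    ring
  have hKq (i : ℕ) (hi : i ∈ Finset.range (2 * m)) : K i * q = N i := by
    rw [Finset.mem_range] at hi
    simp only [K, N, show 2 * m - i = 2 * m - 1 - i + 1 by omega]
    ring
  let ψ (θ : UnitAddCircle) : ℝ :=
    ∑ i ∈ Finset.range (2 * m), w (i + 1) * g (circleDigit ℓ (K i • θ))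
  have hψp (θ : UnitAddCircle) : ψ (p • θ) =
      ∑ i ∈ Finset.range (2 * m), w (i + 1) * g (circleDigit ℓ (N (i + 1) • θ)) :=
    Finset.sum_congr rfl fun i hi => by rw [smul_smul, hKp i hi]
  have hψq (θ : UnitAddCircle) : ψ (q • θ) =
      ∑ i ∈ Finset.range (2 * m), w (i + 1) * g (circleDigit ℓ (N i • θ)) :=
    Finset.sum_congr rfl fun i hi => by rw [smul_smul, hKq i hi]
  refine ⟨ψ, ?_, ?_, ?_, ?_⟩
  · exact Finset.measurable_fun_sum _ fun i _ =>
      (measurable_comp_circleDigit_zsmul ℓ g (K i)).const_mul _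
  · refine ⟨∑ i ∈ Finset.range (2 * m), |w (i + 1)| * ∑ j, |g j|, fun θ => ?_⟩
    refine (Finset.abs_sum_le_sum_abs _ _).trans (Finset.sum_le_sum fun i _ => ?_)
    rw [abs_mul]
    exact mul_le_mul_of_nonneg_left (Finset.single_le_sum (f := fun j => |g j|)
      (fun _ _ => abs_nonneg _) (Finset.mem_univ _)) (abs_nonneg _)
  · have h1 (θ : UnitAddCircle) : Complex.exp (Complex.I * ψ (p • θ)) =
        ∏ i ∈ Finset.range (2 * m),
          Complex.exp (Complex.I * (w (i + 1) * g (circleDigit ℓ (N (i + 1) • θ)) : ℝ)) := by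
      rw [hψp, ← Complex.exp_sum, Complex.ofReal_sum, Finset.mul_sum]
    simp_rw [h1]
    have h2 := integral_prod_circleDigit ℓ (Finset.range (2 * m)) (fun i => N (i + 1))
      (fun i => vN (i + 1)) (fun i => MN (i + 1)) (fun i => hN _) (fun i => hMN _)
      (fun i hi j hj hij => by
        simp only [Finset.coe_range, Set.mem_Iio] at hi hj
        exact Nat.succ_injective (hvN (Set.mem_Iic.2 (by omega)) (Set.mem_Iic.2 (by omega)) hij))
      (fun i j => Complex.exp (Complex.I * (w (i + 1) * g j : ℝ)))
    rw [h2]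
    -- Since m = k + 1, this is the factor of weight w m = 1, whose mean is the vanishing character
    -- sum.
    refine Finset.prod_eq_zero (i := k) (Finset.mem_range.2 (by omega)) ?_
    have : w (k + 1) = 1 := hwm
    simp_rw [this, one_mul, hexp, mul_zero]
  · have h1 (θ : UnitAddCircle) : ψ (p • θ) - ψ (q • θ) =
        ∑ i ∈ Finset.range (2 * m), (w i - w (i + 1)) * g (circleDigit ℓ (N i • θ)) := by
      -- The sum over 0, ..., 2m is split at either end; both boundary terms vanish with w, which
      -- shifts the index at no cost.
      have h2 := Finset.sum_range_succ (fun i => w i * g (circleDigit ℓ (N i • θ))) (2 * m)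
      rw [Finset.sum_range_succ', hw2, hw0, zero_mul, zero_mul, add_zero, add_zero] at h2
      rw [hψp, hψq, h2, ← Finset.sum_sub_distrib]
      exact Finset.sum_congr rfl fun i _ => by ring
    simp_rw [h1]
    rw [integral_sq_sum_circleDigit ℓ (Finset.range (2 * m)) N vN MN hN hMN
      (hvN.mono fun i hi => Set.mem_Iic.2 (by
        simp only [Finset.coe_range, Set.mem_Iio] at hi
        exact hi.le)) _ g hg, ← hV]
    refine le_trans ?_ hmV
    have h3 : ∑ i ∈ Finset.range (2 * m), (w i - w (i + 1)) ^ 2 ≤ 2 / m := by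
      refine (Finset.sum_le_sum fun i _ => hwd i).trans (le_of_eq ?_)
      rw [Finset.sum_const, Finset.card_range, nsmul_eq_mul]
      push_cast
      field_simp
    calc _ ≤ 2 / (m : ℝ) * V := mul_le_mul_of_nonneg_right h3 hV0
      _ = 2 * V / m := by ring

end Circle

/-! ### The group von Neumann algebra in its standard representation -/

namespace GroupVN

variable {G : Type*}

open Classical in
/-- The canonical basis vector `δ_g` of `ℓ²(G)`. -/
noncomputable def delta (g : G) : EllTwo G := lp.single 2 g (1 : ℂ)

open Classical in
theorem delta_apply (g h : G) : delta g h = if h = g then 1 else 0 := by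
  simp [delta, Pi.single_apply]

open Classical in
theorem inner_delta (g : G) (f : EllTwo G) : ⟪delta g, f⟫_ℂ = f g := by
  simp [delta, lp.inner_single_left]

theorem norm_apply_of_mem_unitary {x : EllTwo G →L[ℂ] EllTwo G}
    (hx : x ∈ unitary (EllTwo G →L[ℂ] EllTwo G)) (f : EllTwo G) : ‖x f‖ = ‖f‖ :=
  ContinuousLinearMap.norm_map_of_mem_unitary hx f

theorem hasSum_delta (f : EllTwo G) : HasSum (fun g => f g • delta g) f := by
  classical
  have := lp.hasSum_single (E := fun _ : G => ℂ) (p := 2) (by norm_num) f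
  convert! this using 2 with g
  ext k
  rw [lp.coeFn_smul, Pi.smul_apply, delta_apply, lp.single_apply, Pi.single_apply]
  simp

theorem dense_span_delta :
    Dense (Submodule.span ℂ (Set.range (delta (G := G))) : Set (EllTwo G)) := by
  intro f
  refine mem_closure_of_tendsto (hasSum_delta f) (Filter.Eventually.of_forall fun s => ?_)
  exact Submodule.sum_mem _ fun g _ =>
    Submodule.smul_mem _ _ (Submodule.subset_span ⟨g, rfl⟩)

/-- Isometries are equicontinuous, so convergence on the dense span of the δ_g suffices. -/
theorem cauchySeq_of_isometries {x : ℕ → EllTwo G →L[ℂ] EllTwo G}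
    (hx : ∀ n f, ‖x n f‖ = ‖f‖) (hd : ∀ g, CauchySeq fun n => x n (delta g)) (f : EllTwo G) :
    CauchySeq fun n => x n f := by
  have hspan : ∀ f ∈ Submodule.span ℂ (Set.range (delta (G := G))),
      CauchySeq fun n => x n f := by
    intro f hf
    induction hf using Submodule.span_induction with
    | mem f hf =>
      obtain ⟨g, rfl⟩ := hf
      exact hd g
    | zero =>
      simp only [map_zero]
      exact cauchySeq_const 0
    | add f f' _ _ h h' =>
      simp only [map_add]
      exact h.add h'
    | smul c f _ h =>
      simp only [map_smul]
      exact (uniformContinuous_const_smul c).comp_cauchySeq h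
  refine Metric.cauchySeq_iff'.2 fun ε hε => ?_
  obtain ⟨f', hf', hff'⟩ := Metric.mem_closure_iff.1 (dense_span_delta f) (ε / 3) (by positivity)
  obtain ⟨N, hN⟩ := Metric.cauchySeq_iff'.1 (hspan f' hf') (ε / 3) (by positivity)
  refine ⟨N, fun n hn => ?_⟩
  have h (n : ℕ) : dist (x n f) (x n f') = dist f f' := by
    rw [dist_eq_norm, dist_eq_norm, ← map_sub, hx]
  have h1 := dist_triangle4 (x n f) (x n f') (x N f') (x N f)
  rw [h n, dist_comm (x N f') (x N f), h N] at h1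
  linarith [hN n hn]

variable [Group G]

theorem leftRegular_delta (g h : G) : leftRegular g (delta h) = delta (g * h) := by
  classical
  ext k
  rw [leftRegular_apply, delta_apply, delta_apply]
  exact if_congr inv_mul_eq_iff_eq_mul rfl rfl

theorem leftRegular_mul (g h : G) :
    leftRegular (g * h) = leftRegular g * leftRegular h := by
  ext f k
  simp [mul_assoc]

theorem leftRegular_one : leftRegular (1 : G) = 1 := by
  ext f k
  simp

theorem leftRegular_inv_mul (g : G) : leftRegular g⁻¹ * leftRegular g = 1 := by
  rw [← leftRegular_mul, inv_mul_cancel, leftRegular_one]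

theorem leftRegular_mul_inv (g : G) : leftRegular g * leftRegular g⁻¹ = 1 := by
  rw [← leftRegular_mul, mul_inv_cancel, leftRegular_one]

theorem norm_leftRegular_apply (g : G) (f : EllTwo G) : ‖leftRegular g f‖ = ‖f‖ :=
  (leftTranslation g).norm_map f

theorem inner_leftRegular_apply (g : G) (f f' : EllTwo G) :
    ⟪leftRegular g f, leftRegular g f'⟫_ℂ = ⟪f, f'⟫_ℂ :=
  (leftTranslation g).inner_map_map f f'

theorem star_leftRegular (g : G) : star (leftRegular g) = leftRegular g⁻¹ := by
  rw [ContinuousLinearMap.star_eq_adjoint, eq_comm, ContinuousLinearMap.eq_adjoint_iff]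
  intro f f'
  rw [← inner_leftRegular_apply g, ← mul_apply_eq_comp, leftRegular_mul_inv,
    one_apply_eq_self]

theorem leftRegular_mem_unitary (g : G) :
    leftRegular g ∈ unitary (EllTwo G →L[ℂ] EllTwo G) := by
  rw [Unitary.mem_iff, star_leftRegular]
  exact ⟨leftRegular_inv_mul g, leftRegular_mul_inv g⟩

theorem memEllTwo_rightTranslate (g : G) (f : EllTwo G) : Memℓp (fun h : G => f (h * g)) 2 := by
  have hf := (memℓp_gen_iff (p := 2) (by norm_num)).1 (lp.memℓp f)
  exact (memℓp_gen_iff (p := 2) (by norm_num)).2 (hf.comp_injective (mul_left_injective g))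

/-- Right translation by `g` as a linear isometry of `ℓ²(G)`. -/
noncomputable def rightTranslation (g : G) : EllTwo G →ₗᵢ[ℂ] EllTwo G where
  toFun f := ⟨fun h => f (h * g), memEllTwo_rightTranslate g f⟩
  map_add' _ _ := rfl
  map_smul' _ _ := rfl
  norm_map' f := by
    rw [lp.norm_eq_tsum_rpow (by norm_num), lp.norm_eq_tsum_rpow (by norm_num)]
    congr 1
    exact (Equiv.mulRight g).tsum_eq (fun h => ‖f h‖ ^ (2 : ℝ≥0∞).toReal)

/-- The operators of the right regular representation. -/
noncomputable def rightRegular (g : G) : EllTwo G →L[ℂ] EllTwo G :=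
  (rightTranslation g).toContinuousLinearMap

theorem rightRegular_apply (g : G) (f : EllTwo G) (h : G) : rightRegular g f h = f (h * g) := rfl

theorem norm_rightRegular_apply (g : G) (f : EllTwo G) : ‖rightRegular g f‖ = ‖f‖ :=
  (rightTranslation g).norm_map f

theorem rightRegular_inv_delta_one (g : G) : rightRegular g⁻¹ (delta 1) = delta g := by
  classical
  ext k
  rw [rightRegular_apply, delta_apply, delta_apply]
  exact if_congr mul_inv_eq_one rfl rfl

theorem rightRegular_mul_leftRegular (g h : G) :
    rightRegular g * leftRegular h = leftRegular h * rightRegular g := by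
  ext f k
  simp [rightRegular_apply, mul_assoc]

/-- Adjoints can be dropped from the commutant conditions because the set of u_g is closed under
adjoints. -/
theorem mem_iff {x : EllTwo G →L[ℂ] EllTwo G} : x ∈ groupVonNeumannAlgebra G ↔
    ∀ z : EllTwo G →L[ℂ] EllTwo G, (∀ g, leftRegular g * z = z * leftRegular g) →
      z * x = x * z := by
  have hmem : x ∈ groupVonNeumannAlgebra G ↔ x ∈ StarSubalgebra.centralizer ℂ
    (StarSubalgebra.centralizer ℂ (Set.range (leftRegular (G := G))) :
      Set (EllTwo G →L[ℂ] EllTwo G)) := Iff.rfl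
  have hz (z : EllTwo G →L[ℂ] EllTwo G) :
      z ∈ StarSubalgebra.centralizer ℂ (Set.range (leftRegular (G := G))) ↔
        ∀ g, leftRegular g * z = z * leftRegular g := by
    rw [StarSubalgebra.mem_centralizer_iff]
    constructor
    · exact fun h g => (h _ ⟨g, rfl⟩).1
    · rintro h _ ⟨g, rfl⟩
      exact ⟨h g, by rw [star_leftRegular]; exact h g⁻¹⟩
  rw [hmem, StarSubalgebra.mem_centralizer_iff]
  constructor
  · exact fun h z hz' => (h z ((hz z).2 hz')).1
  · exact fun h z hz' => ⟨h z ((hz z).1 hz'), h _ ((hz _).1 (star_mem hz'))⟩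

theorem leftRegular_mem (g : G) : leftRegular g ∈ groupVonNeumannAlgebra G :=
  mem_iff.2 fun _ hz => (hz g).symm

/-- Right translations lie in the commutant, so an element of LG is determined by its value at δ₁.
-/
theorem apply_delta {x : EllTwo G →L[ℂ] EllTwo G} (hx : x ∈ groupVonNeumannAlgebra G) (g : G) :
    x (delta g) = rightRegular g⁻¹ (x (delta 1)) := by
  have := mem_iff.1 hx (rightRegular g⁻¹) fun h => (rightRegular_mul_leftRegular g⁻¹ h).symm
  rw [← rightRegular_inv_delta_one, ← mul_apply_eq_comp, ← this]
  rfl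

theorem norm_apply_delta {x : EllTwo G →L[ℂ] EllTwo G} (hx : x ∈ groupVonNeumannAlgebra G)
    (g : G) : ‖x (delta g)‖ = ‖x (delta 1)‖ := by
  rw [apply_delta hx, norm_rightRegular_apply]

theorem groupTrace_eq (x : groupVonNeumannAlgebra G) :
    groupTrace x = ⟪delta 1, (x : EllTwo G →L[ℂ] EllTwo G) (delta 1)⟫_ℂ := rfl

theorem groupTwoNorm_eq (x : groupVonNeumannAlgebra G) :
    groupTwoNorm x = ‖(x : EllTwo G →L[ℂ] EllTwo G) (delta 1)‖ := by
  rw [groupTwoNorm, groupTrace_eq]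
  have : ((star x * x : groupVonNeumannAlgebra G) : EllTwo G →L[ℂ] EllTwo G) =
    star (x : EllTwo G →L[ℂ] EllTwo G) * x := rfl
  rw [this, mul_apply_eq_comp, ContinuousLinearMap.star_eq_adjoint,
    ContinuousLinearMap.adjoint_inner_right, inner_self_eq_norm_sq_to_K]
  norm_cast
  exact Real.sqrt_sq (norm_nonneg _)

/-- This is the trace property τ(x x*) = τ(x* x): the coefficient of x*δ₁ at g is the conjugate of
that of xδ₁ at g⁻¹. -/
theorem norm_star_apply_delta_one {x : EllTwo G →L[ℂ] EllTwo G}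
    (hx : x ∈ groupVonNeumannAlgebra G) : ‖star x (delta 1)‖ = ‖x (delta 1)‖ := by
  have h (g : G) : star x (delta 1) g = starRingEnd ℂ (x (delta 1) g⁻¹) := by
    rw [← inner_delta g, ContinuousLinearMap.star_eq_adjoint,
      ContinuousLinearMap.adjoint_inner_right, ← inner_conj_symm, inner_delta, apply_delta hx,
      rightRegular_apply, one_mul]
  rw [lp.norm_eq_tsum_rpow (by norm_num), lp.norm_eq_tsum_rpow (by norm_num)]
  congr 1
  simp only [h, RCLike.norm_conj]
  exact (Equiv.inv G).tsum_eq (fun g => ‖x (delta 1) g‖ ^ (2 : ℝ≥0∞).toReal)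

theorem exists_strong_limit {x : ℕ → EllTwo G →L[ℂ] EllTwo G}
    (hx : ∀ n, x n ∈ groupVonNeumannAlgebra G)
    (hu : ∀ n, x n ∈ unitary (EllTwo G →L[ℂ] EllTwo G))
    (hc : CauchySeq fun n => x n (delta 1)) :
    ∃ y ∈ groupVonNeumannAlgebra G,
      ∀ f, Filter.Tendsto (fun n => x n f) Filter.atTop (nhds (y f)) := by
  have hcauchy := cauchySeq_of_isometries (fun n => norm_apply_of_mem_unitary (hu n))
    fun g => by
      simp only [apply_delta (hx _) g]
      exact (rightTranslation g⁻¹).isometry.uniformContinuous.comp_cauchySeq hc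
  choose y hy using fun f => cauchySeq_tendsto_of_complete (hcauchy f)
  let Y : EllTwo G →L[ℂ] EllTwo G := continuousLinearMapOfTendsto x (tendsto_pi_nhds.2 hy)
  have hY (f : EllTwo G) : Filter.Tendsto (fun n => x n f) Filter.atTop (nhds (Y f)) := hy f
  refine ⟨Y, mem_iff.2 fun z hz => ContinuousLinearMap.ext fun f => ?_, hY⟩
  refine tendsto_nhds_unique ((z.continuous.tendsto _).comp (hY f)) ?_
  refine (hY (z f)).congr fun n => ?_
  exact (DFunLike.congr_fun (mem_iff.1 (hx n) z hz) f).symm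

/-- Unitaries of `LG` which form a Cauchy sequence for the `2`-norm converge strongly to a
unitary of `LG`. -/
theorem exists_unitary_strong_limit {x : ℕ → EllTwo G →L[ℂ] EllTwo G}
    (hx : ∀ n, x n ∈ groupVonNeumannAlgebra G)
    (hu : ∀ n, x n ∈ unitary (EllTwo G →L[ℂ] EllTwo G))
    (hc : CauchySeq fun n => x n (delta 1)) :
    ∃ y ∈ groupVonNeumannAlgebra G, y ∈ unitary (EllTwo G →L[ℂ] EllTwo G) ∧
      ∀ f, Filter.Tendsto (fun n => x n f) Filter.atTop (nhds (y f)) := by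
  obtain ⟨y, hy, hlim⟩ := exists_strong_limit hx hu hc
  -- A strong limit of unitaries is in general only an isometry. The trace property makes the
  -- adjoints converge strongly as well, which gives both unitarity relations.
  have hc' : CauchySeq fun n => star (x n) (delta 1) := by
    rw [Metric.cauchySeq_iff'] at hc ⊢
    intro ε hε
    obtain ⟨N, hN⟩ := hc ε hε
    refine ⟨N, fun n hn => ?_⟩
    have := hN n hn
    rw [dist_eq_norm, ← sub_apply] at this ⊢
    rwa [← star_sub, norm_star_apply_delta_one (sub_mem (hx n) (hx N))]
  obtain ⟨z, -, hlim'⟩ := exists_strong_limit (fun n => star_mem (hx n))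
    (fun n => Unitary.star_mem (hu n)) hc'
  have hz : z = star y := by
    rw [ContinuousLinearMap.star_eq_adjoint, ContinuousLinearMap.eq_adjoint_iff]
    intro f f'
    refine tendsto_nhds_unique ((hlim' f).inner tendsto_const_nhds) ?_
    refine (tendsto_const_nhds.inner (hlim f')).congr fun n => ?_
    rw [ContinuousLinearMap.star_eq_adjoint, ContinuousLinearMap.adjoint_inner_left]
  have hmul {u v : ℕ → EllTwo G →L[ℂ] EllTwo G} {a b : EllTwo G →L[ℂ] EllTwo G}
      (hu : ∀ n, u n ∈ unitary (EllTwo G →L[ℂ] EllTwo G)) (huv : ∀ n, u n * v n = 1)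
      (ha : ∀ f, Filter.Tendsto (fun n => u n f) Filter.atTop (nhds (a f)))
      (hb : ∀ f, Filter.Tendsto (fun n => v n f) Filter.atTop (nhds (b f))) : a * b = 1 := by
    ext1 f
    refine tendsto_nhds_unique (ha (b f)) ?_
    rw [tendsto_iff_norm_sub_tendsto_zero]
    refine (tendsto_iff_norm_sub_tendsto_zero.1 (hb f)).congr fun n => ?_
    have h1 : u n (v n f) = f := DFunLike.congr_fun (huv n) f
    rw [one_apply_eq_self, ← norm_apply_of_mem_unitary (hu n), map_sub, h1,
      norm_sub_rev]
  refine ⟨y, hy, Unitary.mem_iff.2 ⟨?_, ?_⟩, hlim⟩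
  · rw [← hz]
    exact hmul (fun n => Unitary.star_mem (hu n)) (fun n => (Unitary.mem_iff.1 (hu n)).1) hlim' hlim
  · rw [← hz]
    exact hmul hu (fun n => (Unitary.mem_iff.1 (hu n)).2) hlim hlim'

end GroupVN

/-! ### Functional calculus of the unitary u_a on the circle -/

section Calculus

open MeasureTheory AddCircle

/-- The inverse of the parametrization of the unit circle, on the spectrum of a unitary. -/
noncomputable def spectrumToAddCircle {A : Type*} [CStarAlgebra A] {u : A} (hu : u ∈ unitary A) :
    C(spectrum ℂ u, UnitAddCircle) where
  toFun z := (AddCircle.homeomorphCircle (T := 1) one_ne_zero).symm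
    ⟨z, show (z : ℂ) ∈ Submonoid.unitSphere ℂ from spectrum.subset_circle_of_unitary hu z.2⟩
  continuous_toFun := (Homeomorph.continuous _).comp (by fun_prop)

/-- The continuous functional calculus of a unitary, for functions on `ℝ / ℤ`. -/
noncomputable def circleCalculus {A : Type*} [CStarAlgebra A] {u : A} (hu : u ∈ unitary A) :
    C(UnitAddCircle, ℂ) →⋆ₐ[ℂ] A :=
  (cfcHom (IsStarNormal.mk (by
    rw [Commute, SemiconjBy, (Unitary.mem_iff.1 hu).1, (Unitary.mem_iff.1 hu).2]))).comp
    (ContinuousMap.compStarAlgHom' ℂ ℂ (spectrumToAddCircle hu))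

theorem continuous_circleCalculus {A : Type*} [CStarAlgebra A] {u : A} (hu : u ∈ unitary A) :
    Continuous (circleCalculus hu) :=
  (cfcHom_continuous _).comp (ContinuousMap.continuous_precomp _)

theorem circleCalculus_fourier_one {A : Type*} [CStarAlgebra A] {u : A} (hu : u ∈ unitary A) :
    circleCalculus hu (fourier 1) = u := by
  rw [circleCalculus, StarAlgHom.comp_apply]
  conv_rhs => rw [← cfcHom_id (R := ℂ) (a := u) (IsStarNormal.mk (by
    rw [Commute, SemiconjBy, (Unitary.mem_iff.1 hu).1, (Unitary.mem_iff.1 hu).2]))]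
  congr 1
  ext z
  change (fourier 1 (spectrumToAddCircle hu z) : ℂ) = z
  rw [fourier_one, ← AddCircle.homeomorphCircle_apply one_ne_zero]
  exact congrArg (fun c : Circle => (c : ℂ)) (Homeomorph.apply_symm_apply _ _)

/-- Trigonometric polynomials are dense, so identities about the calculus need checking only on
monomials, where they become identities between group elements. -/
theorem fourier_ext {V : Type*} [NormedAddCommGroup V] [NormedSpace ℂ V]
    {L₁ L₂ : C(UnitAddCircle, ℂ) →L[ℂ] V} (h : ∀ n : ℤ, L₁ (fourier n) = L₂ (fourier n)) :
    L₁ = L₂ := by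
  refine ContinuousLinearMap.ext_on (s := Set.range (@fourier (1 : ℝ))) ?_ ?_
  · exact Submodule.dense_iff_topologicalClosure_eq_top.2 span_fourier_closure_eq_top
  · rintro _ ⟨n, rfl⟩
    exact h n

theorem integral_fourier (n : ℤ) :
    ∫ θ : UnitAddCircle, fourier n θ ∂haarAddCircle = if n = 0 then 1 else 0 := by
  have := congrFun (fourierCoeff_fourier (T := 1) n) 0
  simp only [fourierCoeff, neg_zero, fourier_zero, one_smul, Pi.single_apply] at this
  rw [this]
  simp only [eq_comm]

/-- Integration over the circle as a continuous linear functional. -/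
noncomputable def circleIntegralCLM : C(UnitAddCircle, ℂ) →L[ℂ] ℂ :=
  LinearMap.mkContinuous
    { toFun := fun f => ∫ θ, f θ ∂haarAddCircle
      map_add' := fun f g => integral_add
        (f.continuous.integrable_of_hasCompactSupport (HasCompactSupport.of_compactSpace _))
        (g.continuous.integrable_of_hasCompactSupport (HasCompactSupport.of_compactSpace _))
      map_smul' := fun c f => integral_const_mul c _ } 1 fun f => by
    rw [one_mul]
    have := norm_integral_le_of_norm_le_const (μ := haarAddCircle (T := 1))
      (Filter.Eventually.of_forall f.norm_coe_le_norm)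
    simpa using this

namespace GroupVN

variable {G : Type*} [Group G] (a : G)

/-- The functional calculus of the unitary `u_a`. -/
noncomputable def calculus : C(UnitAddCircle, ℂ) →⋆ₐ[ℂ] (EllTwo G →L[ℂ] EllTwo G) :=
  circleCalculus (leftRegular_mem_unitary a)

/-- The functional calculus of the unitary `u_a` as a continuous linear map. -/
noncomputable def calculusCLM : C(UnitAddCircle, ℂ) →L[ℂ] (EllTwo G →L[ℂ] EllTwo G) :=
  ⟨(calculus a).toAlgHom.toLinearMap, continuous_circleCalculus _⟩

theorem calculusCLM_apply (f : C(UnitAddCircle, ℂ)) : calculusCLM a f = calculus a f := rfl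

theorem calculus_fourier (n : ℤ) : calculus a (fourier n) = leftRegular (a ^ n) := by
  have hnat (k : ℕ) : calculus a (fourier k) = leftRegular (a ^ k) := by
    induction k with
    | zero =>
      have : (fourier ((0 : ℕ) : ℤ) : C(UnitAddCircle, ℂ)) = 1 := by ext; simp
      rw [this, map_one, pow_zero, leftRegular_one]
    | succ k ih =>
      have : (fourier ((k + 1 : ℕ) : ℤ) : C(UnitAddCircle, ℂ)) = fourier k * fourier 1 := by
        ext
        rw [Nat.cast_succ, fourier_add]
        rfl
      rw [this, map_mul, ih, pow_succ, leftRegular_mul]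
      congr 1
      exact circleCalculus_fourier_one _
  rcases Int.eq_nat_or_neg n with ⟨k, rfl | rfl⟩
  · rw [hnat, zpow_natCast]
  · have : (fourier (-(k : ℤ)) : C(UnitAddCircle, ℂ)) = star (fourier k) := by
      ext
      rw [fourier_neg]
      rfl
    rw [this, map_star, hnat, star_leftRegular, zpow_neg, zpow_natCast]

variable {a}

theorem calculus_mem (f : C(UnitAddCircle, ℂ)) : calculus a f ∈ groupVonNeumannAlgebra G := by
  refine mem_iff.2 fun z hz => ?_
  have : (ContinuousLinearMap.mul ℂ (EllTwo G →L[ℂ] EllTwo G) z).comp (calculusCLM a) =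
      ((ContinuousLinearMap.mul ℂ (EllTwo G →L[ℂ] EllTwo G)).flip z).comp (calculusCLM a) :=
    fourier_ext fun n => by
      simp only [ContinuousLinearMap.comp_apply, ContinuousLinearMap.mul_apply',
        ContinuousLinearMap.flip_apply, calculusCLM_apply, calculus_fourier]
      exact (hz _).symm
  exact DFunLike.congr_fun this f

/-- Evaluating f(pθ) at u_a amounts to evaluating f at u_(a^p), and conjugation by u_t carries
u_(a^p) to u_(a^q). -/
theorem leftRegular_mul_calculus_comp {t : G} {p q : ℤ} (h : t * a ^ p * t⁻¹ = a ^ q)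
    (f : C(UnitAddCircle, ℂ)) :
    leftRegular t * calculus a (f.comp ⟨fun θ => p • θ, continuous_zsmul p⟩) =
      calculus a (f.comp ⟨fun θ => q • θ, continuous_zsmul q⟩) * leftRegular t := by
  let P (p : ℤ) : C(UnitAddCircle, ℂ) →L[ℂ] C(UnitAddCircle, ℂ) :=
    ⟨(ContinuousMap.compRightAlgHom ℂ ℂ ⟨fun θ => p • θ, continuous_zsmul p⟩).toLinearMap,
      ContinuousMap.continuous_precomp _⟩
  have hP (p n : ℤ) : P p (fourier n) = fourier (p * n) := by
    ext θ
    change fourier n (p • θ) = fourier (p * n) θ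
    simp only [fourier_apply, smul_smul, mul_comm]
  have : (ContinuousLinearMap.mul ℂ (EllTwo G →L[ℂ] EllTwo G) (leftRegular t)).comp
        ((calculusCLM a).comp (P p)) =
      ((ContinuousLinearMap.mul ℂ (EllTwo G →L[ℂ] EllTwo G)).flip (leftRegular t)).comp
        ((calculusCLM a).comp (P q)) := fourier_ext fun n => by
    simp only [ContinuousLinearMap.comp_apply, ContinuousLinearMap.mul_apply',
      ContinuousLinearMap.flip_apply, calculusCLM_apply, hP, calculus_fourier, ← leftRegular_mul]
    congr 1
    rw [zpow_mul, zpow_mul, ← h, conj_zpow]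
    simp
  exact DFunLike.congr_fun this f

/-- Infinite order gives τ(u_(a^n)) = 0 for n ≠ 0, which are the Fourier coefficients of Haar
measure. -/
theorem groupTrace_calculus (ha : ¬ IsOfFinOrder a) (f : C(UnitAddCircle, ℂ)) :
    ⟪delta 1, calculus a f (delta 1)⟫_ℂ = ∫ θ, f θ ∂haarAddCircle := by
  have : ((innerSL ℂ (delta (1 : G))).comp
      (ContinuousLinearMap.apply ℂ (EllTwo G) (delta (1 : G)))).comp (calculusCLM a) =
      circleIntegralCLM := by
    refine fourier_ext fun n => ?_
    change ⟪delta 1, calculus a (fourier n) (delta 1)⟫_ℂ = ∫ θ, fourier n θ ∂haarAddCircle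
    rw [integral_fourier, calculus_fourier, leftRegular_delta, inner_delta, delta_apply, mul_one]
    classical
    refine if_congr ?_ rfl rfl
    rw [eq_comm, ← zpow_zero a]
    exact (injective_zpow_iff_not_isOfFinOrder.2 ha).eq_iff
  exact DFunLike.congr_fun this f

theorem enorm_calculus_delta_one (ha : ¬ IsOfFinOrder a) (f : C(UnitAddCircle, ℂ)) :
    ‖calculus a f (delta 1)‖ₑ = eLpNorm f 2 haarAddCircle := by
  have h1 : ‖calculus a f (delta 1)‖ ^ 2 = ∫ θ, ‖f θ‖ ^ 2 ∂haarAddCircle := by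
    have h2 := groupTrace_calculus ha (star f * f)
    rw [map_mul, map_star, mul_apply_eq_comp, ContinuousLinearMap.star_eq_adjoint,
      ContinuousLinearMap.adjoint_inner_right, inner_self_eq_norm_sq_to_K] at h2
    have h3 (θ : UnitAddCircle) : (star f * f) θ = ((‖f θ‖ ^ 2 : ℝ) : ℂ) := by
      change star (f θ) * f θ = _
      rw [RCLike.star_def, RCLike.conj_mul]
      norm_cast
    simp_rw [h3, integral_complex_ofReal] at h2
    exact Complex.ofReal_injective (by rw [Complex.ofReal_pow]; exact h2)
  have hf : MemLp f 2 (haarAddCircle (T := 1)) :=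
    f.continuous.memLp_of_hasCompactSupport (HasCompactSupport.of_compactSpace _)
  rw [hf.eLpNorm_eq_integral_rpow_norm (by norm_num) (by norm_num)]
  simp only [ENNReal.toReal_ofNat, Real.rpow_ofNat]
  rw [← h1, ← ofReal_norm]
  congr 1
  rw [← Real.rpow_natCast, ← Real.rpow_mul (norm_nonneg _)]
  norm_num

end GroupVN

end Calculus

/-! ### From measurable phases to property Gamma -/

section Limit

open MeasureTheory AddCircle Filter Topology

theorem measurePreserving_zsmul_haarAddCircle {p : ℤ} (hp : p ≠ 0) :
    MeasurePreserving (fun θ : UnitAddCircle => p • θ) haarAddCircle haarAddCircle :=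
  Measure.measurePreserving_zsmul haarAddCircle hp

theorem norm_exp_I_mul_sub_exp_I_mul_le (x y : ℝ) :
    ‖Complex.exp (Complex.I * x) - Complex.exp (Complex.I * y)‖ ≤ ‖x - y‖ := by
  have : Complex.exp (Complex.I * x) - Complex.exp (Complex.I * y) =
      Complex.exp (Complex.I * y) * (Complex.exp (Complex.I * (x - y : ℝ)) - 1) := by
    rw [mul_sub, ← Complex.exp_add, mul_one]
    congr 2
    push_cast
    ring
  rw [this, norm_mul, mul_comm Complex.I, Complex.norm_exp_ofReal_mul_I, one_mul]
  exact Real.norm_exp_I_mul_ofReal_sub_one_le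

/-- The unimodular continuous function `exp (i f)`. -/
noncomputable def expPhase (f : C(UnitAddCircle, ℝ)) : C(UnitAddCircle, ℂ) :=
  ⟨fun θ => Complex.exp (Complex.I * f θ), by fun_prop⟩

theorem star_expPhase_mul_self (f : C(UnitAddCircle, ℝ)) : star (expPhase f) * expPhase f = 1 := by
  ext θ
  change star (Complex.exp (Complex.I * f θ)) * Complex.exp (Complex.I * f θ) = 1
  rw [RCLike.star_def, RCLike.conj_mul, mul_comm Complex.I, Complex.norm_exp_ofReal_mul_I]
  simp

theorem exists_continuous_approx {ψ : UnitAddCircle → ℝ} (hm : Measurable ψ)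
    (hb : ∃ C, ∀ θ, |ψ θ| ≤ C) (n : ℕ) : ∃ f : C(UnitAddCircle, ℝ),
      eLpNorm (ψ - ⇑f) 2 haarAddCircle ≤ ENNReal.ofReal (1 / ((n : ℝ) + 1)) := by
  obtain ⟨C, hC⟩ := hb
  have hψ : MemLp ψ 2 (haarAddCircle (T := 1)) :=
    MemLp.of_bound hm.aestronglyMeasurable C (Eventually.of_forall hC)
  obtain ⟨f, hf, -⟩ := hψ.exists_boundedContinuous_eLpNorm_sub_le (by norm_num)
    (ε := ENNReal.ofReal (1 / ((n : ℝ) + 1))) (by simpa using by positivity)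
  exact ⟨f.toContinuousMap, hf⟩

namespace GroupVN

variable {G : Type*} [Group G] {a : G}

theorem calculus_expPhase_mem_unitary (f : C(UnitAddCircle, ℝ)) :
    calculus a (expPhase f) ∈ unitary (EllTwo G →L[ℂ] EllTwo G) := by
  rw [Unitary.mem_iff, ← map_star, ← map_mul, ← map_mul, mul_comm (expPhase f),
    star_expPhase_mul_self, map_one]
  exact ⟨rfl, rfl⟩

theorem leftRegular_mul_calculus {g : G} (hg : Commute g a) (f : C(UnitAddCircle, ℂ)) :
    leftRegular g * calculus a f = calculus a f * leftRegular g := by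
  have h1 : f.comp ⟨fun θ => (1 : ℤ) • θ, continuous_zsmul 1⟩ = f := by
    ext θ
    simp
  have := leftRegular_mul_calculus_comp (t := g) (p := 1) (q := 1) (a := a)
    (by rw [zpow_one, hg.eq, mul_inv_cancel_right]) f
  rwa [h1] at this

/-- A bounded measurable phase function `ψ` on the circle defines a unitary of `LG` as a function
of `u_a`. -/
theorem exists_unitary_of_phase (ha : ¬ IsOfFinOrder a) {t : G} {p q : ℤ}
    (hp : p ≠ 0) (hq : q ≠ 0) (ht : t * a ^ p * t⁻¹ = a ^ q) {ψ : UnitAddCircle → ℝ}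
    (hm : Measurable ψ) (hb : ∃ C, ∀ θ, |ψ θ| ≤ C) :
    ∃ x ∈ groupVonNeumannAlgebra G, x ∈ unitary (EllTwo G →L[ℂ] EllTwo G) ∧
      ⟪delta 1, x (delta 1)⟫_ℂ =
        ∫ θ : UnitAddCircle, Complex.exp (Complex.I * ψ (p • θ)) ∂haarAddCircle ∧
      (∀ g, Commute g a → x * leftRegular g = leftRegular g * x) ∧
      ‖(x * leftRegular t - leftRegular t * x) (delta 1)‖ₑ ≤
        eLpNorm (fun θ : UnitAddCircle => ψ (p • θ) - ψ (q • θ)) 2 haarAddCircle := by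
  choose f hf using exists_continuous_approx hm hb
  let M (p : ℤ) : C(UnitAddCircle, UnitAddCircle) := ⟨fun θ => p • θ, continuous_zsmul p⟩
  have hMp {p : ℤ} (hp : p ≠ 0) : MeasurePreserving (M p) haarAddCircle haarAddCircle :=
    measurePreserving_zsmul_haarAddCircle hp
  let e (n : ℕ) : ℝ≥0∞ := ENNReal.ofReal (1 / ((n : ℝ) + 1))
  have he : Tendsto e atTop (𝓝 0) := by
    have := ENNReal.tendsto_ofReal (tendsto_one_div_add_atTop_nhds_zero_nat (𝕜 := ℝ))
    rwa [ENNReal.ofReal_zero] at this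
  -- Multiplication by a nonzero integer preserves Haar measure, so one approximation of ψ serves at
  -- both pθ and qθ.
  have hfm {p : ℤ} (hp : p ≠ 0) (n : ℕ) :
      eLpNorm ((ψ - ⇑(f n)) ∘ M p) 2 haarAddCircle ≤ e n := by
    rw [eLpNorm_comp_measurePreserving (hm.sub (f n).measurable).aestronglyMeasurable (hMp hp)]
    exact hf n
  let F (n : ℕ) (p : ℤ) : C(UnitAddCircle, ℂ) := (expPhase (f n)).comp (M p)
  let x (n : ℕ) : EllTwo G →L[ℂ] EllTwo G := calculus a (F n p)
  have hx (n : ℕ) : x n ∈ groupVonNeumannAlgebra G := calculus_mem _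
  have hu (n : ℕ) : x n ∈ unitary (EllTwo G →L[ℂ] EllTwo G) :=
    calculus_expPhase_mem_unitary ((f n).comp (M p))
  have hmono (g₁ g₂ : C(UnitAddCircle, ℝ)) :
      ‖calculus a (expPhase g₁ - expPhase g₂) (delta 1)‖ₑ ≤ eLpNorm (⇑g₁ - ⇑g₂) 2 haarAddCircle := by
    rw [enorm_calculus_delta_one ha]
    exact eLpNorm_mono fun θ => norm_exp_I_mul_sub_exp_I_mul_le _ _
  have hc : CauchySeq fun n => x n (delta 1) := by
    refine cauchySeq_of_le_tendsto_0 (fun n : ℕ => 2 * (1 / ((n : ℝ) + 1))) (fun n m N hn hm' => ?_)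
      (by simpa using (tendsto_one_div_add_atTop_nhds_zero_nat (𝕜 := ℝ)).const_mul 2)
    rw [dist_eq_norm, ← sub_apply, ← map_sub]
    have h1 := hmono ((f n).comp (M p)) ((f m).comp (M p))
    have h2 : (⇑((f n).comp (M p)) - ⇑((f m).comp (M p))) =
        (ψ - ⇑(f m)) ∘ M p - (ψ - ⇑(f n)) ∘ M p := by
      ext θ
      simp
    rw [h2] at h1
    have h3 := h1.trans ((eLpNorm_sub_le
      ((hm.sub (f m).measurable).comp (M p).measurable).aestronglyMeasurable
      ((hm.sub (f n).measurable).comp (M p).measurable).aestronglyMeasurable (by norm_num)).trans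
        (add_le_add (hfm hp m) (hfm hp n)))
    have h4 (n : ℕ) (hn : N ≤ n) : e n ≤ e N :=
      ENNReal.ofReal_le_ofReal (one_div_le_one_div_of_le (by positivity) (by gcongr))
    have h5 := h3.trans (add_le_add (h4 m hm') (h4 n hn))
    rw [← ENNReal.ofReal_add (by positivity) (by positivity), ← two_mul, ← ofReal_norm] at h5
    exact (ENNReal.ofReal_le_ofReal_iff (by positivity)).1 h5
  obtain ⟨y, hy, hyu, hlim⟩ := exists_unitary_strong_limit hx hu hc
  refine ⟨y, hy, hyu, ?_, fun g hg => ?_, ?_⟩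
  · have hE : AEStronglyMeasurable
        (fun θ : UnitAddCircle => Complex.exp (Complex.I * ψ (p • θ))) haarAddCircle :=
      (Complex.measurable_exp.comp ((Complex.measurable_ofReal.comp
        (hm.comp (M p).measurable)).const_mul Complex.I)).aestronglyMeasurable
    refine tendsto_nhds_unique (tendsto_const_nhds.inner (hlim (delta 1))) ?_
    simp only [x, groupTrace_calculus ha]
    refine tendsto_integral_of_L1' _ ?_ (Eventually.of_forall fun n =>
      (F n p).continuous.integrable_of_hasCompactSupport (HasCompactSupport.of_compactSpace _)) ?_
    · exact hE
    · refine tendsto_of_tendsto_of_tendsto_of_le_of_le tendsto_const_nhds he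
        (fun _ => zero_le) fun n => ?_
      -- Haar measure is a probability measure, so the L² approximation bounds the L¹ distance
      -- needed for convergence of integrals.
      refine (eLpNorm_le_eLpNorm_of_exponent_le (q := 2) (by norm_num) ?_).trans
        (le_trans ?_ (hfm hp n))
      · exact (F n p).measurable.aestronglyMeasurable.sub hE
      · refine eLpNorm_mono fun θ => ?_
        refine (norm_exp_I_mul_sub_exp_I_mul_le (f n (p • θ)) (ψ (p • θ))).trans (le_of_eq ?_)
        exact norm_sub_rev _ _
  · ext1 ξ
    refine tendsto_nhds_unique (hlim (leftRegular g ξ)) ?_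
    refine (((leftRegular g).continuous.tendsto _).comp (hlim ξ)).congr fun n => ?_
    exact DFunLike.congr_fun (leftRegular_mul_calculus hg (F n p)) ξ
  · have h1 : Tendsto (fun n => ‖(x n * leftRegular t - leftRegular t * x n) (delta 1)‖ₑ) atTop
        (𝓝 ‖(y * leftRegular t - leftRegular t * y) (delta 1)‖ₑ) := by
      refine (continuous_enorm.tendsto _).comp ?_
      exact (hlim (leftRegular t (delta 1))).sub
        (((leftRegular t).continuous.tendsto _).comp (hlim (delta 1)))
    have h2 (n : ℕ) : ‖(x n * leftRegular t - leftRegular t * x n) (delta 1)‖ₑ ≤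
        eLpNorm (fun θ : UnitAddCircle => ψ (p • θ) - ψ (q • θ)) 2 haarAddCircle +
          (e n + e n) := by
      -- Moving u_t to the right turns the commutator into a function of u_a followed by u_t, and
      -- u_t does not affect the 2-norm.
      have h3 : x n * leftRegular t - leftRegular t * x n =
          calculus a (F n p - F n q) * leftRegular t := by
        rw [leftRegular_mul_calculus_comp ht, map_sub, sub_mul]
      have h4 : ‖(calculus a (F n p - F n q) * leftRegular t) (delta 1)‖ₑ =
          ‖calculus a (F n p - F n q) (delta 1)‖ₑ := by
        rw [mul_apply_eq_comp, leftRegular_delta, mul_one, ← ofReal_norm,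
          norm_apply_delta (calculus_mem _), ofReal_norm]
      rw [h3, h4]
      refine (hmono ((f n).comp (M p)) ((f n).comp (M q))).trans ?_
      have h5 : (⇑((f n).comp (M p)) - ⇑((f n).comp (M q))) =
          (fun θ : UnitAddCircle => ψ (p • θ) - ψ (q • θ)) -
            ((ψ - ⇑(f n)) ∘ M p - (ψ - ⇑(f n)) ∘ M q) := by
        ext θ
        simp [M]
        ring
      have m1 (p : ℤ) : Measurable fun θ : UnitAddCircle => ψ (p • θ) := hm.comp (M p).measurable
      have m2 (p : ℤ) : Measurable ((ψ - ⇑(f n)) ∘ M p) :=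
        (hm.sub (f n).measurable).comp (M p).measurable
      rw [h5]
      refine (eLpNorm_sub_le ((m1 p).sub (m1 q)).aestronglyMeasurable
        ((m2 p).sub (m2 q)).aestronglyMeasurable (by norm_num)).trans (add_le_add le_rfl ?_)
      exact (eLpNorm_sub_le (m2 p).aestronglyMeasurable (m2 q).aestronglyMeasurable
        (by norm_num)).trans (add_le_add (hfm hp n) (hfm hq n))
    refine le_of_tendsto_of_tendsto' h1 ?_ h2
    simpa using tendsto_const_nhds.add (he.add he)

theorem exists_almost_commuting_unitary (ha : ¬ IsOfFinOrder a) {t : G} {p q : ℤ}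
    (hp : p ≠ 0) (hq : q ≠ 0) (hpq : |p| ≠ |q|) (ht : t * a ^ p * t⁻¹ = a ^ q) {ε : ℝ}
    (hε : 0 < ε) :
    ∃ x : groupVonNeumannAlgebra G,
      (x : EllTwo G →L[ℂ] EllTwo G) ∈ unitary (EllTwo G →L[ℂ] EllTwo G) ∧ groupTrace x = 0 ∧
      (∀ g, Commute g a → (x : EllTwo G →L[ℂ] EllTwo G) * leftRegular g = leftRegular g * x) ∧
      ‖((x : EllTwo G →L[ℂ] EllTwo G) * leftRegular t - leftRegular t * x) (delta 1)‖ ≤ ε := by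
  -- The phase function is controlled through a squared L² norm, hence ε².
  obtain ⟨ψ, hm, hb, hz, hd⟩ := exists_phase_function hp hq hpq (ε := ε ^ 2) (by positivity)
  obtain ⟨x, hx, hu, htr, hc, hn⟩ := exists_unitary_of_phase ha hp hq ht hm hb
  refine ⟨⟨x, hx⟩, hu, by rw [groupTrace_eq]; exact htr.trans hz, hc, ?_⟩
  have hmem : MemLp (fun θ : UnitAddCircle => ψ (p • θ) - ψ (q • θ)) 2 haarAddCircle := by
    obtain ⟨C, hC⟩ := hb
    refine MemLp.of_bound ((hm.comp (continuous_zsmul p).measurable).sub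
      (hm.comp (continuous_zsmul q).measurable)).aestronglyMeasurable (C + C)
      (Eventually.of_forall fun θ => ?_)
    exact (abs_sub _ _).trans (add_le_add (hC _) (hC _))
  rw [hmem.eLpNorm_eq_integral_rpow_norm (by norm_num) (by norm_num)] at hn
  simp only [ENNReal.toReal_ofNat, Real.rpow_ofNat, Real.norm_eq_abs, sq_abs] at hn
  rw [← ofReal_norm, ENNReal.ofReal_le_ofReal_iff (by positivity)] at hn
  refine hn.trans ?_
  calc _ ≤ (ε ^ 2) ^ (2 : ℝ)⁻¹ := Real.rpow_le_rpow (by positivity) hd (by norm_num)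
    _ = ε := by
      rw [← Real.rpow_natCast, ← Real.rpow_mul hε.le]
      norm_num

/-- The elements of `G` whose unitaries asymptotically commute with a sequence in `LG`. -/
def asymptoticCentralizer (x : ℕ → EllTwo G →L[ℂ] EllTwo G)
    (hx : ∀ n, x n ∈ groupVonNeumannAlgebra G) : Subgroup G where
  carrier := {g | Tendsto (fun n => ‖(x n * leftRegular g - leftRegular g * x n) (delta 1)‖)
    atTop (𝓝 0)}
  one_mem' := by simp [leftRegular_one]
  mul_mem' := by
    intro g h hg hh
    rw [Set.mem_ofPred_eq] at hg hh ⊢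
    refine squeeze_zero (fun _ => norm_nonneg _) (fun n => ?_) (by simpa using hg.add hh)
    -- Leibniz rule for the commutator; multiplying an element of LG by a group unitary on either
    -- side preserves the 2-norm.
    have h1 : x n * leftRegular (g * h) - leftRegular (g * h) * x n =
        (x n * leftRegular g - leftRegular g * x n) * leftRegular h +
          leftRegular g * (x n * leftRegular h - leftRegular h * x n) := by
      rw [leftRegular_mul]
      noncomm_ring
    have hmem := sub_mem (mul_mem (hx n) (leftRegular_mem g)) (mul_mem (leftRegular_mem g) (hx n))
    rw [h1, add_apply]
    refine (norm_add_le _ _).trans (add_le_add (le_of_eq ?_) (le_of_eq ?_))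
    · rw [mul_apply_eq_comp, leftRegular_delta, norm_apply_delta hmem]
      rfl
    · rw [mul_apply_eq_comp, norm_leftRegular_apply]
      rfl
  inv_mem' := by
    intro g hg
    rw [Set.mem_ofPred_eq] at hg ⊢
    refine hg.congr fun n => ?_
    have h1 : x n * leftRegular g⁻¹ - leftRegular g⁻¹ * x n =
        -(leftRegular g⁻¹ * (x n * leftRegular g - leftRegular g * x n) * leftRegular g⁻¹) := by
      rw [mul_sub, sub_mul, ← mul_assoc (leftRegular g⁻¹) (leftRegular g), leftRegular_inv_mul,
        one_mul, mul_assoc (leftRegular g⁻¹), mul_assoc (x n), leftRegular_mul_inv, mul_one,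
        neg_sub]
    have hmem := sub_mem (mul_mem (hx n) (leftRegular_mem g)) (mul_mem (leftRegular_mem g) (hx n))
    rw [h1, neg_apply, norm_neg, mul_apply_eq_comp, leftRegular_delta, mul_apply_eq_comp,
      norm_leftRegular_apply]
    exact (norm_apply_delta hmem _).symm

/-- A sequence of unitaries that asymptotically commutes with the group unitaries asymptotically
commutes with the whole von Neumann algebra. -/
theorem tendsto_commutator {x : ℕ → EllTwo G →L[ℂ] EllTwo G}
    (hx : ∀ n, x n ∈ groupVonNeumannAlgebra G)
    (hu : ∀ n, x n ∈ unitary (EllTwo G →L[ℂ] EllTwo G))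
    (hg : asymptoticCentralizer x hx = ⊤) {y : EllTwo G →L[ℂ] EllTwo G}
    (hy : y ∈ groupVonNeumannAlgebra G) :
    Tendsto (fun n => ‖(x n * y - y * x n) (delta 1)‖) atTop (𝓝 0) := by
  rw [Metric.tendsto_atTop]
  intro ε hε
  -- A finite combination z of group unitaries approximates y in 2-norm within ε/4. The commutator
  -- with z contributes ε/4 and the two terms in y − z contribute ε/4 each.
  obtain ⟨s, hs⟩ := ((hasSum_delta (y (delta 1))).eventually
    (Metric.ball_mem_nhds _ (ε := ε / 4) (by positivity))).exists
  let z : EllTwo G →L[ℂ] EllTwo G := ∑ g ∈ s, (y (delta 1) g) • leftRegular g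
  have hz : z ∈ groupVonNeumannAlgebra G := sum_mem fun g _ =>
    (groupVonNeumannAlgebra G).toStarSubalgebra.smul_mem (leftRegular_mem g) _
  have hzy : ‖(y - z) (delta 1)‖ < ε / 4 := by
    rw [sub_apply, ← dist_eq_norm, dist_comm]
    have : z (delta 1) = ∑ g ∈ s, y (delta 1) g • delta g := by
      simp [z, leftRegular_delta]
    rw [this]
    exact hs
  have hlim : Tendsto (fun n => ‖(x n * z - z * x n) (delta 1)‖) atTop (𝓝 0) := by
    have h1 : Tendsto (fun n => ∑ g ∈ s, ‖y (delta 1) g‖ *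
        ‖(x n * leftRegular g - leftRegular g * x n) (delta 1)‖) atTop (𝓝 0) := by
      rw [← Finset.sum_const_zero (s := s)]
      refine tendsto_finsetSum _ fun g _ => ?_
      have : g ∈ asymptoticCentralizer x hx := hg ▸ Subgroup.mem_top g
      simpa using Tendsto.const_mul ‖y (delta 1) g‖ this
    refine squeeze_zero (fun _ => norm_nonneg _) (fun n => ?_) h1
    have h2 : x n * z - z * x n =
        ∑ g ∈ s, y (delta 1) g • (x n * leftRegular g - leftRegular g * x n) := by
      simp only [z, Finset.mul_sum, Finset.sum_mul, mul_smul_comm, smul_mul_assoc, smul_sub,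
        Finset.sum_sub_distrib]
    rw [h2, sum_apply]
    refine (norm_sum_le _ _).trans (le_of_eq (Finset.sum_congr rfl fun g _ => ?_))
    rw [smul_apply, norm_smul]
  obtain ⟨N, hN⟩ := (Metric.tendsto_atTop.1 hlim) (ε / 4) (by positivity)
  refine ⟨N, fun n hn => ?_⟩
  have h1 := hN n hn
  rw [dist_zero_right, norm_norm] at h1 ⊢
  have h2 : x n * y - y * x n = (x n * z - z * x n) + (x n * (y - z) - (y - z) * x n) := by
    noncomm_ring
  have hw := sub_mem hy hz
  have h3 : ‖(x n * (y - z)) (delta 1)‖ = ‖(y - z) (delta 1)‖ := by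
    rw [mul_apply_eq_comp, norm_apply_of_mem_unitary (hu n)]
  -- Right multiplication by a unitary preserves the 2-norm: by the trace property it may be
  -- replaced by left multiplication of the adjoint.
  have h4 : ‖((y - z) * x n) (delta 1)‖ = ‖(y - z) (delta 1)‖ := by
    rw [← norm_star_apply_delta_one (mul_mem hw (hx n)), star_mul, mul_apply_eq_comp,
      norm_apply_of_mem_unitary (Unitary.star_mem (hu n)), norm_star_apply_delta_one hw]
  rw [h2, add_apply]
  refine (norm_add_le _ _).trans_lt ?_
  have h5 := norm_sub_le ((x n * (y - z)) (delta 1)) (((y - z) * x n) (delta 1))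
  rw [← sub_apply, h3, h4] at h5
  linarith

/-- The unitaries commute exactly with the centralizer of a and asymptotically with t, so the
subgroup they asymptotically centralize contains a generating set. -/
theorem hasPropertyGamma (ha : ¬ IsOfFinOrder a) {t : G} {p q : ℤ}
    (hp : p ≠ 0) (hq : q ≠ 0) (hpq : |p| ≠ |q|) (ht : t * a ^ p * t⁻¹ = a ^ q)
    (hgen : Subgroup.closure ({g | Commute g a} ∪ {t}) = ⊤) : GroupVNHasPropertyGamma G := by
  choose x hu htr hc hn using fun n : ℕ => exists_almost_commuting_unitary ha hp hq hpq ht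
    (ε := 1 / ((n : ℝ) + 1)) (by positivity)
  refine ⟨x, hu, htr, fun y => ?_⟩
  simp only [groupTwoNorm_eq]
  refine tendsto_commutator (fun n => (x n).2) hu (eq_top_iff.2 ?_) y.2
  rw [← hgen, Subgroup.closure_le]
  rintro g (hg | hg)
  · change Tendsto _ _ _
    simp [hc _ g hg]
  · rw [Set.mem_singleton_iff] at hg
    subst hg
    exact squeeze_zero (fun _ => norm_nonneg _) hn tendsto_one_div_add_atTop_nhds_zero_nat

end GroupVN

end Limit

theorem theorem1p2 {E : Type*} [Group E] (a : E) (ha : a ∈ Subgroup.center E)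
    (ha' : ¬ IsOfFinOrder a) (p q : ℤ) (hp : p ≠ 0) (hq : q ≠ 0) (hpq : |p| ≠ |q|) :
    IsICC (OneStableLetterGroup E a p q) ∧
      GroupVNHasPropertyGamma (OneStableLetterGroup E a p q) := by
  refine ⟨OneStableLetterGroup.isICC ha' hp hq hpq,
    GroupVN.hasPropertyGamma (a := OneStableLetterGroup.base a p q a)
      (t := OneStableLetterGroup.stable a p q) ?_ hp hq hpq ?_ ?_⟩
  · rwa [(OneStableLetterGroup.base_injective ha' hp hq).isOfFinOrder_iff]
  · have := OneStableLetterGroup.stable_mul_base_mul_inv a p q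
    rwa [map_zpow (OneStableLetterGroup.base a p q) a p,
      map_zpow (OneStableLetterGroup.base a p q) a q] at this
  -- Centrality of a in E puts the image of E in the centralizer of the image of a, so this
  -- centralizer and t generate Γ.
  · rw [eq_top_iff, ← OneStableLetterGroup.closure_base_union_stable a p q]
    refine Subgroup.closure_mono (Set.union_subset_union_left _ ?_)
    rintro _ ⟨e, rfl⟩
    exact (show Commute e a from Subgroup.mem_center_iff.1 ha e).map _
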